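/- Let $G$ be a finite multigraph with totally ordered edge set $E(G)$. An enhanced state of $G$ is a pair $S=(s,c)$, where $s\subseteq E(G)$ and $c$ assigns $1$ or $x$ to each connected component of the spanning subgraph $[G:s]$; let $i(S)=\#s$ and let $j(S)$ be the number of components coloured $x$. Let $C^{i,j}(G)$ be the free abelian group on the enhanced states with $i(S)=i$, $j(S)=j$, and let $\partial(S)=\sum_{e\in E(G)\setminus s}(-1)^{n(e)}S_e$, where $n(e)=\#\{f\in s: f<e\}$ and $S_e$ has edge set $s\cup\{e\}$ and the colouring in which the components merged by $e$ have their colours multiplied in $\mathbb{Z}[x]/(x^2)$ (so $S_e=0$ if two components coloured $x$ are merged). The chromatic homology groups $H^{i,j}(G)$ and $H^i(G)$ are the cohomology groups of $(C^{\ast,j}(G),\partial)$ and of $C^\ast(G)=\bigoplus_{j\ge 0}C^{\ast,j}(G)$. Let $n\ge 4$ and, for $1\le m\le n-1$, let $K_{n-1}^m$ be the graph obtained from the complete graph $K_{n-1}$ on $\{1,\dots,n-1\}$ by adding one vertex $n$ and the $m$ edges $\{t,n\}$, $1\le t\le m$, with edges ordered lexicographically. Let $2\le m\le n-1$, $G=K_{n-1}^m$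 and $e=\{m,n\}$. Then $G-e=K_{n-1}^{m-1}$, and deleting from $G/e$ the edges $\{t,n\}$ with $t<m$ (each of which is parallel in $G/e$ to the edge $\{t,m\}$) gives $K_{n-1}$. The deletion map induces isomorphisms $H^{i,j}(G/e)\cong H^{i,j}(K_{n-1})$ and $H^{i}(G/e)\cong H^{i}(K_{n-1})$. With these identifications, for all $i\in\mathbb{Z}$ and $j\ge 0$ (in particular whenever $i+j=n-1$ or $i+j=n$) the sequence $$0\to H^{i,j}(K_{n-1})\xrightarrow{\ \alpha^*\ } H^{i+1,j}(K_{n-1}^m)\xrightarrow{\ \beta^*\ } H^{i+1,j}(K_{n-1}^{m-1})\to 0$$ is a split short exact sequence, and summing over $j$, for all $i\in\mathbb{Z}$ the sequence $$0\to H^{i}(K_{n-1})\xrightarrow{\ \alpha^*\ } H^{i+1}(K_{n-1}^m)\xrightarrow{\ \beta^*\ } H^{i+1}(K_{n-1}^{m-1})\to 0$$ is a split short exact sequence. Here $\alpha^*$ is induced by adding the edge $e$ to an enhanced state of $G/e$, $(s,c)\mapsto(-1)^{\#\{f\in s:\,f>e\}}(s\cup\{e\},\tilde c)$, where corresponding components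 have the same colour, and $\beta^*$ is induced by $(s,c)\mapsto(s,c)$ if $e\notin s$ and $(s,c)\mapsto 0$ if $e\in s$. -/

import Mathlib

namespace ChromaticHomology

open Graph Set

noncomputable section

/-! ### Multigraphs -/

section Graphs

variable {α β : Type*}

/-- The contraction `G / e` of an edge `e` of `G` with ends `x` and `y`: the edge `e` is removed and
the vertex `y` is identified with `x`. Edges that become parallel are kept as distinct edges, so the
edge set of `G / e` is `E(G) \ {e}`. -/
def contract (G : Graph α β) (e : β) (x y : α) : Graph α β :=
  open Classical in (G.deleteEdges {e}).map (fun v => if v = y then x else v)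

/-- The complete graph on the vertices `1, …, k`; the edge joining `a < b` is labelled `(a, b)`, and
the edges are ordered lexicographically. -/
def complete (k : ℕ) : Graph ℕ (ℕ ×ₗ ℕ) where
  vertexSet := Icc 1 k
  edgeSet := {e | 1 ≤ (ofLex e).1 ∧ (ofLex e).1 < (ofLex e).2 ∧ (ofLex e).2 ≤ k}
  IsLink e u v := 1 ≤ (ofLex e).1 ∧ (ofLex e).1 < (ofLex e).2 ∧ (ofLex e).2 ≤ k ∧
    (((ofLex e).1 = u ∧ (ofLex e).2 = v) ∨ ((ofLex e).1 = v ∧ (ofLex e).2 = u))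
  isLink_symm e _ := ⟨fun u v h => by grind⟩
  eq_or_eq_of_isLink_of_isLink e x y v w h h' := by grind
  edge_mem_iff_exists_isLink e :=
    ⟨fun h => ⟨_, _, h.1, h.2.1, h.2.2, Or.inl ⟨rfl, rfl⟩⟩, fun ⟨_, _, h⟩ => ⟨h.1, h.2.1, h.2.2.1⟩⟩
  left_mem_of_isLink e x y h := by simp only [mem_Icc]; grind

/-- The graph `K_{n-1}^m`: the complete graph on the vertices `1, …, n - 1` together with one more
vertex `n` and the `m` edges joining `n` to the vertices `1, …, m`. -/
def completeAdd (n m : ℕ) : Graph ℕ (ℕ ×ₗ ℕ) :=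
  (complete n).deleteEdges {e | (ofLex e).2 = n ∧ m < (ofLex e).1}

end Graphs

/-! ### Enhanced states -/

section States

variable {α β : Type*}

/-- The connected components of the spanning subgraph `[G : s]`. -/
abbrev Comp (G : Graph α β) (s : Finset β) : Type _ :=
  (G.restrict (s : Set β)).toSimpleGraph.ConnectedComponent

/-- The component of `[G : s]` that contains the vertex `v`. -/
def compOf (G : Graph α β) (s : Finset β) (v : V(G)) : Comp G s :=
  (G.restrict (s : Set β)).toSimpleGraph.connectedComponentMk v

/-- An enhanced state of `G`: a finite set `s` of edges and a colouring of the components of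
`[G : s]` by `1` and `x`, recorded as the set of components coloured `x`. -/
@[ext]
structure State (G : Graph α β) where
  edges : Finset β
  edges_subset : (edges : Set β) ⊆ E(G)
  colX : Set (Comp G edges)

variable {G H : Graph α β}

/-- The map of components induced by a map of vertices that sends adjacent vertices into one
component. -/
def compMap {s t : Finset β} (f : V(G) → V(H))
    (hf : ∀ u v : V(G), (G.restrict (s : Set β)).Adj u v → compOf H t (f u) = compOf H t (f v)) :
    Comp G s → Comp H t :=
  SimpleGraph.ConnectedComponent.lift (fun v => compOf H t (f v)) (by
    intro u v p _
    induction p with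
    | nil => rfl
    | cons h p ih => exact (hf _ _ h.2).trans (ih (SimpleGraph.Walk.IsPath.of_cons ‹_›)))

lemma compMap_compOf {s t : Finset β} (f : V(G) → V(H)) (hf) (v : V(G)) :
    compMap (s := s) (t := t) f hf (compOf G s v) = compOf H t (f v) := rfl

lemma compOf_surjective (s : Finset β) : Function.Surjective (compOf G s) := by
  intro c
  induction c using SimpleGraph.ConnectedComponent.ind with
  | h v => exact ⟨v, rfl⟩

lemma compOf_eq_of_adj {s : Finset β} {u v : V(G)} (h : (G.restrict (s : Set β)).Adj u v) :
    compOf G s u = compOf G s v := by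
  by_cases huv : u = v
  · rw [huv]
  · exact SimpleGraph.ConnectedComponent.eq.2 (SimpleGraph.Adj.reachable ⟨huv, h⟩)

lemma compMap_bijective {s t : Finset β} (f : V(G) → V(H)) (hf)
    (hsurj : Function.Surjective f)
    (heq : ∀ u v : V(G), f u = f v → compOf G s u = compOf G s v)
    (hadj : ∀ u v : V(H), (H.restrict (t : Set β)).Adj u v →
      ∃ u' v' : V(G), f u' = u ∧ f v' = v ∧ compOf G s u' = compOf G s v') :
    Function.Bijective (compMap (s := s) (t := t) f hf) := by
  refine ⟨?_, ?_⟩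
  · have key : ∀ a b : V(H), compOf H t a = compOf H t b → ∀ u v : V(G), f u = a → f v = b →
        compOf G s u = compOf G s v := by
      intro a b hab
      obtain ⟨p⟩ := SimpleGraph.ConnectedComponent.exact hab
      induction p with
      | nil => intro u v hu hv; exact heq _ _ (hu.trans hv.symm)
      | @cons a c b h p ih =>
        intro u v hu hv
        obtain ⟨u', c', hu', hc', h'⟩ := hadj _ _ h.2
        have h1 := heq u u' (hu.trans hu'.symm)
        exact h1.trans (h'.trans (ih (SimpleGraph.ConnectedComponent.sound ⟨p⟩) c' v hc' hv))
    intro a b hab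
    obtain ⟨u, rfl⟩ := compOf_surjective _ a
    obtain ⟨v, rfl⟩ := compOf_surjective _ b
    exact key _ _ hab u v rfl rfl
  · intro b
    obtain ⟨v, rfl⟩ := compOf_surjective _ b
    obtain ⟨u, rfl⟩ := hsurj v
    exact ⟨compOf G s u, rfl⟩

/-- For `s ⊆ t`, the component of `[G : t]` that contains a given component of `[G : s]`. -/
def push {s t : Finset β} (h : s ⊆ t) : Comp G s → Comp G t :=
  compMap id (fun _ _ huv => compOf_eq_of_adj (huv.mono
    (G.restrict_mono_right (Finset.coe_subset.2 h))))

@[simp] lemma push_compOf {s t : Finset β} (h : s ⊆ t) (v : V(G)) :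
    push h (compOf G s v) = compOf G t v := rfl

lemma push_push {s t r : Finset β} (h : s ⊆ t) (h' : t ⊆ r) (c : Comp G s) :
    push h' (push h c) = push (h.trans h') c := by
  obtain ⟨v, rfl⟩ := compOf_surjective _ c
  rfl

end States

/-! ### The chromatic complex -/

section Complex

variable {α β : Type*}

/-- The free abelian group on the enhanced states of `G`. -/
abbrev Chains (G : Graph α β) : Type _ := State G →₀ ℤ

variable {G H : Graph α β}

open Classical in
/-- The enhanced state with edge set `t ⊇ s` obtained from the enhanced state `S = (s, c)`: the
colour of a component of `[G : t]` is the product in `ℤ[x]/(x²)` of the colours of the components of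
`[G : s]` that it contains. The result is `0` if two components coloured `x` are merged. Otherwise a
component of `[G : t]` is coloured `x` exactly if it contains a component coloured `x`. -/
def State.extend (S : State G) (t : Finset β) : Chains G :=
  if h : S.edges ⊆ t ∧ (t : Set β) ⊆ E(G) then
    if InjOn (push h.1) S.colX then Finsupp.single ⟨t, h.2, push h.1 '' S.colX⟩ 1 else 0
  else 0

variable [LinearOrder β]

/-- `n(e)`: the number of edges in `s` that are ordered before `e`. -/
def before (s : Finset β) (e : β) : ℕ := (s.filter (· < e)).card

/-- The edges of `G` that do not lie in `s`, as a finite set. -/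
def newEdges (G : Graph α β) [Finite E(G)] (s : Finset β) : Finset β :=
  (Set.toFinite E(G)).toFinset \ s

lemma mem_newEdges [Finite E(G)] {s : Finset β} {e : β} :
    e ∈ newEdges G s ↔ e ∈ E(G) ∧ e ∉ s := by
  simp [newEdges]

/-- The boundary of an enhanced state: the sum of `(-1)^{n(e)} S_e` over the edges `e` of `G` that
are not in `s`. -/
def State.boundary [Finite E(G)] (S : State G) : Chains G :=
  ∑ e ∈ newEdges G S.edges, (-1 : ℤ) ^ before S.edges e • S.extend (insert e S.edges)

/-- The differential of the chromatic complex of the finite multigraph `G`. -/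
def d (G : Graph α β) [Finite E(G)] : Chains G →ₗ[ℤ] Chains G :=
  Finsupp.linearCombination ℤ State.boundary

@[simp] lemma d_single [Finite E(G)] (S : State G) :
    d G (Finsupp.single S 1) = S.boundary := by
  simp [d]

lemma insert_subset_edgeSet {s : Finset β} {e : β} (hs : (s : Set β) ⊆ E(G)) (he : e ∈ E(G)) :
    ((insert e s : Finset β) : Set β) ⊆ E(G) := by
  rw [Finset.coe_insert]
  exact Set.insert_subset he hs

lemma d_extend [Finite E(G)] (S : State G) (t : Finset β) (h : S.edges ⊆ t)
    (ht : (t : Set β) ⊆ E(G)) :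
    d G (S.extend t) = ∑ e ∈ newEdges G t, (-1 : ℤ) ^ before t e • S.extend (insert e t) := by
  have hcomp : ∀ (r : Finset β) (hr : t ⊆ r), push (G := G) (h.trans hr) = push hr ∘ push h :=
    fun r hr => funext fun c => (push_push h hr c).symm
  by_cases hi : InjOn (push (G := G) h) S.colX
  · rw [State.extend, dif_pos ⟨h, ht⟩, if_pos hi, d_single, State.boundary]
    refine Finset.sum_congr rfl fun e he => ?_
    congr 1
    have hr : t ⊆ insert e t := Finset.subset_insert _ _
    have hrE := insert_subset_edgeSet ht (mem_newEdges.1 he).1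
    simp only [State.extend]
    rw [dif_pos ⟨hr, hrE⟩, dif_pos ⟨h.trans hr, hrE⟩]
    by_cases hj : InjOn (push (G := G) hr) (push h '' S.colX)
    · rw [if_pos hj, if_pos (by rw [hcomp _ hr]; exact hj.comp hi (mapsTo_image _ _)),
        ← image_comp, ← hcomp _ hr]
    · rw [if_neg hj, if_neg]
      rw [hcomp _ hr]
      exact fun hc => hj hc.image_of_comp
  · rw [State.extend, dif_pos ⟨h, ht⟩, if_neg hi, map_zero]
    refine (Finset.sum_eq_zero fun e he => ?_).symm
    have hr : t ⊆ insert e t := Finset.subset_insert _ _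
    have hrE := insert_subset_edgeSet ht (mem_newEdges.1 he).1
    rw [State.extend, dif_pos ⟨h.trans hr, hrE⟩, if_neg, smul_zero]
    rw [hcomp _ hr]
    exact fun hc => hi fun a ha b hb hab => hc ha hb (congrArg (push hr) hab)

lemma before_insert {s : Finset β} {e f : β} (he : e ∉ s) :
    before (insert e s) f = before s f + if e < f then 1 else 0 := by
  unfold before
  rw [Finset.filter_insert]
  split_ifs with h
  · rw [Finset.card_insert_of_notMem (by simp [he])]
  · rfl

lemma d_comp_d [Finite E(G)] (z : Chains G) : d G (d G z) = 0 := by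
  suffices h : d G ∘ₗ d G = 0 from LinearMap.congr_fun h z
  refine Finsupp.lhom_ext' fun S => LinearMap.ext_ring ?_
  simp only [LinearMap.comp_apply, Finsupp.lsingle_apply, d_single, LinearMap.zero_apply]
  rw [State.boundary, map_sum]
  have h1 : ∀ e ∈ newEdges G S.edges,
      d G ((-1 : ℤ) ^ before S.edges e • S.extend (insert e S.edges)) =
      ∑ f ∈ newEdges G (insert e S.edges), ((-1 : ℤ) ^ before S.edges e *
        (-1) ^ before (insert e S.edges) f) • S.extend (insert f (insert e S.edges)) := by
    intro e he
    rw [map_smul, d_extend S _ (Finset.subset_insert _ _)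
      (insert_subset_edgeSet S.edges_subset (mem_newEdges.1 he).1), Finset.smul_sum]
    simp only [smul_smul]
  rw [Finset.sum_congr rfl h1, Finset.sum_sigma']
  refine Finset.sum_involution (fun p _ => ⟨p.2, p.1⟩) ?_ ?_ ?_ ?_
  · rintro ⟨e, f⟩ hp
    simp only [Finset.mem_sigma, mem_newEdges, Finset.mem_insert, not_or] at hp
    obtain ⟨⟨-, he⟩, -, hfe, hf⟩ := hp
    simp only [before_insert he, before_insert hf, Finset.insert_comm f e]
    rw [← add_smul]
    rcases lt_or_gt_of_ne hfe with h | h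
    · rw [if_neg h.le.not_gt, if_pos h]
      convert zero_smul ℤ _ using 2
      ring
    · rw [if_pos h, if_neg h.le.not_gt]
      convert zero_smul ℤ _ using 2
      ring
  · rintro ⟨e, f⟩ hp _ heq
    simp only [Finset.mem_sigma, mem_newEdges, Finset.mem_insert, not_or] at hp
    exact hp.2.2.1 (congrArg Sigma.fst heq)
  · rintro ⟨e, f⟩ hp
    simp only [Finset.mem_sigma, mem_newEdges, Finset.mem_insert, not_or] at hp ⊢
    exact ⟨⟨hp.2.1, hp.2.2.2⟩, hp.1.1, fun h => hp.2.2.1 h.symm, hp.1.2⟩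
  · rintro ⟨e, f⟩ hp
    rfl

/-! ### Gradings and homology -/

/-- The submodule spanned by the enhanced states with `i` edges whose number of components coloured
`x` lies in `J`: it is `C^{i,j}(G)` for `J = {j}` and `C^i(G) = ⨁ j, C^{i,j}(G)` for `J = univ`. -/
def cochains (G : Graph α β) (i : ℤ) (J : Set ℕ) : Submodule ℤ (Chains G) :=
  Finsupp.supported ℤ ℤ {S : State G | (S.edges.card : ℤ) = i ∧ S.colX.ncard ∈ J}

/-- The kernel of `∂` on `cochains G i J`. -/
def cocycles (G : Graph α β) [Finite E(G)] (i : ℤ) (J : Set ℕ) : Submodule ℤ (Chains G) :=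
  cochains G i J ⊓ LinearMap.ker (d G)

/-- The image of `∂` on `cochains G (i - 1) J`. -/
def coboundaries (G : Graph α β) [Finite E(G)] (i : ℤ) (J : Set ℕ) : Submodule ℤ (Chains G) :=
  (cochains G (i - 1) J).map (d G)

lemma extend_mem_cochains (S : State G) (t : Finset β) (i : ℤ) (J : Set ℕ)
    (ht : (t.card : ℤ) = i) (hJ : S.colX.ncard ∈ J) : S.extend t ∈ cochains G i J := by
  unfold State.extend
  split_ifs with h hi
  · refine Finsupp.single_mem_supported ℤ _ ⟨ht, ?_⟩
    rwa [hi.ncard_image]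
  · exact zero_mem _
  · exact zero_mem _

lemma d_mem_cochains [Finite E(G)] {i i' : ℤ} (hi : i + 1 = i') {J : Set ℕ} {z : Chains G}
    (hz : z ∈ cochains G i J) : d G z ∈ cochains G i' J := by
  rw [cochains, Finsupp.supported_eq_span_single] at hz
  refine Submodule.span_le (p := (cochains G i' J).comap (d G)) |>.2 ?_ hz
  rintro _ ⟨S, ⟨hS, hJ⟩, rfl⟩
  simp only [SetLike.mem_coe, Submodule.mem_comap, d_single, State.boundary]
  refine Submodule.sum_mem _ fun e he => Submodule.smul_mem _ _ ?_
  refine extend_mem_cochains S _ _ _ ?_ hJ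
  rw [Finset.card_insert_of_notMem (mem_newEdges.1 he).2]
  push_cast
  omega

lemma coboundaries_le_cocycles [Finite E(G)] (i : ℤ) (J : Set ℕ) :
    coboundaries G i J ≤ cocycles G i J := by
  rintro _ ⟨z, hz, rfl⟩
  exact ⟨d_mem_cochains (by ring) hz, d_comp_d z⟩

/-- The homology of the part of the chromatic complex in `x`-degrees `J`. -/
abbrev Homology (G : Graph α β) [Finite E(G)] (i : ℤ) (J : Set ℕ) : Type _ :=
  cocycles G i J ⧸ (coboundaries G i J).submoduleOf (cocycles G i J)

/-- The bigraded chromatic homology `H^{i,j}(G)`. -/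
abbrev BiHomology (G : Graph α β) [Finite E(G)] (i : ℤ) (j : ℕ) : Type _ := Homology G i {j}

/-- The chromatic homology `H^i(G)`, the homology of `C^i(G) = ⨁ j, C^{i,j}(G)`. -/
abbrev TotalHomology (G : Graph α β) [Finite E(G)] (i : ℤ) : Type _ := Homology G i univ

/-- The map on homology induced by a homomorphism of the chain groups that commutes with the
differentials and sends edge degree `i` to edge degree `i'`. -/
def Homology.map [Finite E(G)] [Finite E(H)] (φ : Chains G →ₗ[ℤ] Chains H)
    (hφ : ∀ z, d H (φ z) = φ (d G z)) (i i' : ℤ) (J : Set ℕ)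
    (h0 : ∀ z ∈ cochains G i J, φ z ∈ cochains H i' J)
    (h1 : ∀ z ∈ cochains G (i - 1) J, φ z ∈ cochains H (i' - 1) J) :
    Homology G i J →ₗ[ℤ] Homology H i' J :=
  Submodule.mapQ _ _
    (φ.restrict (p := cocycles G i J) (q := cocycles H i' J) fun z hz =>
      ⟨h0 z hz.1, by
        have h : d G z = 0 := hz.2
        change d H (φ z) = 0
        rw [hφ, h, map_zero]⟩)
    (by
      rintro ⟨z, hz⟩ ⟨w, hw, hwz⟩
      exact ⟨φ w, h1 w hw, by rw [hφ, hwz]; rfl⟩)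

set_option linter.unusedSectionVars false

/-! ### The maps `β` (deletion) and `α` (contraction) -/

lemma extend_square {A A' B B' : Type*} {ρ : A → A'} {ρ' : B → B'} {φ : A → B} {φ' : A' → B'}
    (hρ : Function.Bijective ρ) (hρ' : Function.Bijective ρ') (h : ∀ a, φ' (ρ a) = ρ' (φ a))
    (X : Set A') :
    (InjOn φ (ρ ⁻¹' X) ↔ InjOn φ' X) ∧ φ '' (ρ ⁻¹' X) = ρ' ⁻¹' (φ' '' X) := by
  refine ⟨⟨?_, ?_⟩, ?_⟩
  · intro hi a ha b hb hab
    obtain ⟨a, rfl⟩ := hρ.2 a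
    obtain ⟨b, rfl⟩ := hρ.2 b
    rw [h, h] at hab
    rw [hi ha hb (hρ'.1 hab)]
  · intro hi a ha b hb hab
    exact hρ.1 (hi ha hb (by rw [h, h, hab]))
  · ext b
    constructor
    · rintro ⟨a, ha, rfl⟩
      exact ⟨ρ a, ha, h a⟩
    · rintro ⟨a, ha, hab⟩
      obtain ⟨a, rfl⟩ := hρ.2 a
      exact ⟨a, ha, hρ'.1 (by rw [← h, hab])⟩

/-- For a spanning subgraph `H` of `G`: the component of `[G : s]` that contains a given component
of `[H : s]`. -/
def delComp (h : H ≤s G) (s : Finset β) : Comp H s → Comp G s :=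
  compMap (fun v => ⟨v.1, h.vertexSet_eq ▸ v.2⟩) (fun _ _ huv =>
    compOf_eq_of_adj (huv.mono (restrict_mono_left h.le _)))

lemma delComp_bijective (h : H ≤s G) {s : Finset β} (hs : (s : Set β) ⊆ E(H)) :
    Function.Bijective (delComp h s) := by
  refine compMap_bijective _ _ ?_ ?_ ?_
  · exact fun v => ⟨⟨v.1, h.vertexSet_eq.symm ▸ v.2⟩, rfl⟩
  · intro u v huv
    rw [Subtype.ext (Subtype.mk.inj huv)]
  · rintro u v ⟨f, hf, huv⟩
    refine ⟨⟨u.1, h.vertexSet_eq.symm ▸ u.2⟩, ⟨v.1, h.vertexSet_eq.symm ▸ v.2⟩, rfl, rfl, ?_⟩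
    exact compOf_eq_of_adj ⟨f, hf, (h.le.isLink_iff (hs hf)).2 huv⟩

open Classical in
/-- The image of an enhanced state of `G` in a spanning subgraph `H`: the same enhanced state if all
its edges are edges of `H`, and `0` otherwise. -/
def State.del (h : H ≤s G) (S : State G) : Chains H :=
  if hs : (S.edges : Set β) ⊆ E(H) then
    Finsupp.single ⟨S.edges, hs, delComp h S.edges ⁻¹' S.colX⟩ 1
  else 0

/-- The homomorphism `β : C(G) → C(H)` for a spanning subgraph `H` of `G`. For `H = G - e` it sends
an enhanced state `(s, c)` to itself if `e ∉ s`, and to `0` if `e ∈ s`. -/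
def delMap (h : H ≤s G) : Chains G →ₗ[ℤ] Chains H :=
  Finsupp.linearCombination ℤ (State.del h)

@[simp] lemma delMap_single (h : H ≤s G) (S : State G) :
    delMap h (Finsupp.single S 1) = S.del h := by
  simp [delMap]

lemma delMap_extend_of_not_subset (h : H ≤s G) (S : State G) (t : Finset β)
    (ht : ¬ (t : Set β) ⊆ E(H)) : delMap h (S.extend t) = 0 := by
  unfold State.extend
  split_ifs with h1 h2
  · rw [delMap_single, State.del, dif_neg ht]
  · exact map_zero _
  · exact map_zero _

lemma delMap_extend (h : H ≤s G) (S : State G) (hs : (S.edges : Set β) ⊆ E(H)) (t : Finset β)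
    (ht : (t : Set β) ⊆ E(H)) :
    delMap h (S.extend t) =
      (⟨S.edges, hs, delComp h S.edges ⁻¹' S.colX⟩ : State H).extend t := by
  by_cases hst : S.edges ⊆ t
  · have htG : (t : Set β) ⊆ E(G) := ht.trans h.le.edgeSet_mono
    obtain ⟨h1, h2⟩ := extend_square (φ := push hst) (φ' := push hst)
      (delComp_bijective h hs) (delComp_bijective h ht) (fun a => by
        obtain ⟨v, rfl⟩ := compOf_surjective _ a
        rfl) S.colX
    simp only [State.extend]
    rw [dif_pos ⟨hst, htG⟩, dif_pos ⟨hst, ht⟩]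
    by_cases hi : InjOn (push (G := G) hst) S.colX
    · rw [if_pos hi, if_pos (h1.2 hi), delMap_single, State.del, dif_pos ht, h2]
    · rw [if_neg hi, if_neg (fun h' => hi (h1.1 h')), map_zero]
  · simp only [State.extend]
    rw [dif_neg (fun h' => hst h'.1), dif_neg (fun h' => hst h'.1), map_zero]

lemma d_delMap [Finite E(G)] [Finite E(H)] (h : H ≤s G) (z : Chains G) :
    d H (delMap h z) = delMap h (d G z) := by
  suffices h' : d H ∘ₗ delMap h = delMap h ∘ₗ d G from LinearMap.congr_fun h' z
  refine Finsupp.lhom_ext' fun S => LinearMap.ext_ring ?_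
  simp only [LinearMap.comp_apply, Finsupp.lsingle_apply, d_single, delMap_single]
  rw [State.boundary, map_sum]
  simp only [map_smul]
  by_cases hs : (S.edges : Set β) ⊆ E(H)
  · rw [State.del, dif_pos hs, d_single, State.boundary]
    refine Finset.sum_subset_zero_on_sdiff ?_ ?_ ?_
    · intro e he
      rw [mem_newEdges] at he ⊢
      exact ⟨h.le.edgeSet_mono he.1, he.2⟩
    · intro e he
      rw [Finset.mem_sdiff, mem_newEdges, mem_newEdges] at he
      rw [delMap_extend_of_not_subset, smul_zero]
      intro h'
      exact he.2 ⟨h' (by simp), he.1.2⟩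
    · intro e he
      rw [mem_newEdges] at he
      rw [delMap_extend h S hs _ (insert_subset_edgeSet hs he.1)]
  · rw [State.del, dif_neg hs, map_zero]
    refine (Finset.sum_eq_zero fun e he => ?_).symm
    rw [delMap_extend_of_not_subset, smul_zero]
    intro h'
    exact hs (subset_trans (Finset.coe_subset.2 (Finset.subset_insert _ _)) h')

lemma delMap_mem_cochains (h : H ≤s G) {i : ℤ} {J : Set ℕ} {z : Chains G}
    (hz : z ∈ cochains G i J) : delMap h z ∈ cochains H i J := by
  rw [cochains, Finsupp.supported_eq_span_single] at hz
  refine Submodule.span_le (p := (cochains H i J).comap (delMap h)) |>.2 ?_ hz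
  rintro _ ⟨S, ⟨hS, hJ⟩, rfl⟩
  simp only [SetLike.mem_coe, Submodule.mem_comap, delMap_single, State.del]
  split_ifs with hs
  · refine Finsupp.single_mem_supported ℤ _ ⟨hS, ?_⟩
    have hb := delComp_bijective h hs
    rwa [ncard_preimage_of_injective_subset_range hb.1 (by simp [hb.2.range_eq])]
  · exact zero_mem _

/-- The map `β^* : H^i(G) → H^i(H)` on homology for a spanning subgraph `H` of `G`. -/
def betaStar [Finite E(G)] [Finite E(H)] (h : H ≤s G) (i : ℤ) (J : Set ℕ) :
    Homology G i J →ₗ[ℤ] Homology H i J :=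
  Homology.map (delMap h) (d_delMap h) i i J (fun _ => delMap_mem_cochains h)
    (fun _ => delMap_mem_cochains h)

/-- The map `V(G) → V(G / e)` that identifies the ends of `e`. -/
def contractVertex (G : Graph α β) (e : β) (x y : α) (v : V(G)) : V(contract G e x y) :=
  open Classical in ⟨if v.1 = y then x else v.1, v.1, v.2, rfl⟩

variable {e : β} {x y : α}

lemma contractVertex_eq (he : G.IsLink e x y) {u v : V(G)}
    (h : contractVertex G e x y u = contractVertex G e x y v) :
    u = v ∨ G.IsLink e u v := by
  have h' := congrArg Subtype.val h
  simp only [contractVertex] at h'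
  split_ifs at h' with h1 h2 h2
  · exact Or.inl (Subtype.ext (h1.trans h2.symm))
  · exact Or.inr (by rw [h1, ← h']; exact he.symm)
  · exact Or.inr (by rw [h2, h']; exact he)
  · exact Or.inl (Subtype.ext h')

lemma contractVertex_eq_of_isLink (he : G.IsLink e x y) {u v : V(G)} (h : G.IsLink e u v) :
    contractVertex G e x y u = contractVertex G e x y v := by
  apply Subtype.ext
  simp only [contractVertex]
  rcases he.eq_and_eq_or_eq_and_eq h with ⟨h1, h2⟩ | ⟨h1, h2⟩
  · rw [← h1, ← h2]; simp
  · rw [← h1, ← h2]; simp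

/-- The component of `[G / e : s]` that corresponds to a component of `[G : s ∪ {e}]`. -/
def contractComp (he : G.IsLink e x y) (s : Finset β) :
    Comp G (insert e s) → Comp (contract G e x y) s :=
  compMap (contractVertex G e x y) (by
    rintro u v ⟨f, hf, huv⟩
    by_cases hfe : f = e
    · rw [contractVertex_eq_of_isLink he (hfe ▸ huv)]
    · have hfs : f ∈ s := by simpa [hfe] using hf
      exact compOf_eq_of_adj ⟨f, hfs, u.1, v.1, ⟨huv, hfe⟩, rfl, rfl⟩)

lemma contractComp_bijective (he : G.IsLink e x y) (s : Finset β) :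
    Function.Bijective (contractComp he s) := by
  refine compMap_bijective _ _ ?_ ?_ ?_
  · rintro ⟨_, v, hv, rfl⟩
    exact ⟨⟨v, hv⟩, rfl⟩
  · intro u v huv
    rcases contractVertex_eq he huv with h | h
    · rw [h]
    · exact compOf_eq_of_adj ⟨e, by simp, h⟩
  · rintro ⟨u, hu⟩ ⟨v, hv⟩ ⟨f, hf, u', v', ⟨hl, -⟩, h1, h2⟩
    refine ⟨⟨u', hl.left_mem⟩, ⟨v', hl.right_mem⟩, Subtype.ext h1, Subtype.ext h2, ?_⟩
    exact compOf_eq_of_adj ⟨f, by simp [Finset.mem_coe.1 hf], hl⟩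

lemma expand_subset (he : G.IsLink e x y) {s : Finset β}
    (hs : (s : Set β) ⊆ E(contract G e x y)) : ((insert e s : Finset β) : Set β) ⊆ E(G) :=
  insert_subset_edgeSet (fun _ hf => (hs hf).1) he.edge_mem

/-- The enhanced state `(s ∪ {e}, c̃)` of `G` obtained from an enhanced state `(s, c)` of `G / e`:
corresponding components have the same colour. -/
def State.expand (he : G.IsLink e x y) (S : State (contract G e x y)) : State G :=
  ⟨insert e S.edges, expand_subset he S.edges_subset, contractComp he S.edges ⁻¹' S.colX⟩

/-- The number of edges in `s` that are ordered after `e`. -/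
def after (s : Finset β) (e : β) : ℕ := (s.filter (e < ·)).card

/-- The homomorphism `α : C(G / e) → C(G)`, which sends `(s, c)` to `(s ∪ {e}, c̃)` up to sign. The
sign, which is `1` if `e` is the last edge of `G`, makes `α` commute with the differentials. -/
def expandMap (he : G.IsLink e x y) : Chains (contract G e x y) →ₗ[ℤ] Chains G :=
  Finsupp.linearCombination ℤ fun S =>
    (-1 : ℤ) ^ after S.edges e • Finsupp.single (S.expand he) 1

@[simp] lemma expandMap_single (he : G.IsLink e x y) (S : State (contract G e x y)) :
    expandMap he (Finsupp.single S 1) =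
      (-1 : ℤ) ^ after S.edges e • Finsupp.single (S.expand he) 1 := by
  simp only [expandMap, Finsupp.linearCombination_single, one_smul]

lemma expandMap_extend (he : G.IsLink e x y) (S : State (contract G e x y)) (t : Finset β)
    (ht : (t : Set β) ⊆ E(contract G e x y)) (hst : S.edges ⊆ t) :
    expandMap he (S.extend t) = (-1 : ℤ) ^ after t e • (S.expand he).extend (insert e t) := by
  have hst' : insert e S.edges ⊆ insert e t := Finset.insert_subset_insert _ hst
  obtain ⟨h1, h2⟩ := extend_square (φ := push (G := G) hst') (φ' := push hst)
    (ρ := contractComp he S.edges) (ρ' := contractComp he t)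
    (contractComp_bijective he S.edges) (contractComp_bijective he t) (fun a => by
      obtain ⟨v, rfl⟩ := compOf_surjective _ a
      rfl) S.colX
  change _ = _ • State.extend (⟨insert e S.edges, expand_subset he S.edges_subset,
    contractComp he S.edges ⁻¹' S.colX⟩ : State G) (insert e t)
  simp only [State.extend]
  rw [dif_pos ⟨hst, ht⟩, dif_pos ⟨hst', expand_subset he ht⟩]
  by_cases hi : InjOn (push (G := contract G e x y) hst) S.colX
  · rw [if_pos hi, if_pos (h1.2 hi), expandMap_single]
    congr 2
    simp only [State.expand, State.mk.injEq, heq_eq_eq, true_and]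
    exact h2.symm
  · rw [if_neg hi, if_neg (fun h' => hi (h1.1 h')), map_zero, smul_zero]

lemma after_insert {s : Finset β} {e f : β} (hf : f ∉ s) :
    after (insert f s) e = after s e + if e < f then 1 else 0 := by
  unfold after
  rw [Finset.filter_insert]
  split_ifs with h
  · rw [Finset.card_insert_of_notMem (by simp [hf])]
  · rfl

instance finite_contract [Finite E(G)] : Finite E(contract G e x y) :=
  (Set.toFinite E(G)).subset fun _ hf => hf.1

lemma d_expandMap [Finite E(G)] (he : G.IsLink e x y) (z : Chains (contract G e x y)) :
    d G (expandMap he z) = expandMap he (d (contract G e x y) z) := by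
  suffices h : d G ∘ₗ expandMap he = expandMap he ∘ₗ d (contract G e x y) from
    LinearMap.congr_fun h z
  refine Finsupp.lhom_ext' fun S => LinearMap.ext_ring ?_
  simp only [LinearMap.comp_apply, Finsupp.lsingle_apply, d_single, expandMap_single, map_smul]
  rw [State.boundary, State.boundary, map_sum, Finset.smul_sum]
  have heS : e ∉ S.edges := fun h => (S.edges_subset h).2 rfl
  have hN : newEdges G (S.expand he).edges = newEdges (contract G e x y) S.edges := by
    ext f
    rw [mem_newEdges, mem_newEdges]
    change f ∈ E(G) ∧ f ∉ insert e S.edges ↔ (f ∈ E(G) ∧ f ∉ ({e} : Set β)) ∧ f ∉ S.edges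
    rw [Finset.mem_insert, mem_singleton_iff]
    tauto
  rw [hN]
  refine Finset.sum_congr rfl fun f hf => ?_
  rw [mem_newEdges] at hf
  rw [map_smul, expandMap_extend he S _ (insert_subset_edgeSet S.edges_subset hf.1)
    (Finset.subset_insert _ _), smul_smul, smul_smul, Finset.insert_comm e f]
  congr 1
  change _ * (-1) ^ before (insert e S.edges) f = _
  rw [before_insert heS, after_insert hf.2]
  ring

lemma expandMap_mem_cochains (he : G.IsLink e x y) {i i' : ℤ} (hi : i + 1 = i') {J : Set ℕ}
    {z : Chains (contract G e x y)} (hz : z ∈ cochains (contract G e x y) i J) :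
    expandMap he z ∈ cochains G i' J := by
  rw [cochains, Finsupp.supported_eq_span_single] at hz
  refine Submodule.span_le (p := (cochains G i' J).comap (expandMap he)) |>.2 ?_ hz
  rintro _ ⟨S, ⟨hS, hJ⟩, rfl⟩
  simp only [SetLike.mem_coe, Submodule.mem_comap, expandMap_single]
  refine Submodule.smul_mem _ _ (Finsupp.single_mem_supported ℤ _ ⟨?_, ?_⟩)
  · have heS : e ∉ S.edges := fun h => (S.edges_subset h).2 rfl
    change ((insert e S.edges).card : ℤ) = i'
    rw [Finset.card_insert_of_notMem heS]
    push_cast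
    omega
  · have hb := contractComp_bijective he S.edges
    change (contractComp he S.edges ⁻¹' S.colX).ncard ∈ J
    rwa [ncard_preimage_of_injective_subset_range hb.1 (by simp [hb.2.range_eq])]

/-- The map `α^* : H^i(G / e) → H^{i+1}(G)` on homology. -/
def alphaStar [Finite E(G)] (he : G.IsLink e x y) (i : ℤ) (J : Set ℕ) :
    Homology (contract G e x y) i J →ₗ[ℤ] Homology G (i + 1) J :=
  Homology.map (expandMap he) (d_expandMap he) i (i + 1) J
    (fun _ => expandMap_mem_cochains he rfl)
    (fun _ => expandMap_mem_cochains he (by ring))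

end Complex

/-- `0 → A → B → C → 0` is a split short exact sequence. -/
def IsSplitShortExact {A B C : Type*} [AddCommGroup A] [AddCommGroup B] [AddCommGroup C]
    (f : A →ₗ[ℤ] B) (g : B →ₗ[ℤ] C) : Prop :=
  Function.Injective f ∧ Function.Exact f g ∧ Function.Surjective g ∧
    ∃ σ : C →ₗ[ℤ] B, g ∘ₗ σ = LinearMap.id

/-! ### The graphs `K_{n-1}^m` -/

section CompleteGraphs

instance finite_complete (k : ℕ) : Finite E(complete k) := by
  refine Set.Finite.subset (((Set.finite_Iic k).prod (Set.finite_Iic k)).image toLex) ?_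
  rintro e ⟨-, h1, h2⟩
  exact ⟨ofLex e, ⟨by simp only [mem_Iic]; omega, h2⟩, rfl⟩

instance finite_completeAdd (n m : ℕ) : Finite E(completeAdd n m) :=
  (Set.toFinite E(complete n)).subset fun _ hf => hf.1

/-- The edge `{m, n}` of `K_{n-1}^m`. -/
lemma isLink_completeAdd {n m : ℕ} (hm : 1 ≤ m) (hmn : m < n) :
    (completeAdd n m).IsLink (toLex (m, n)) m n :=
  ⟨⟨hm, hmn, le_rfl, Or.inl ⟨rfl, rfl⟩⟩, fun h => absurd h.2 (lt_irrefl _)⟩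

/-- The graph `K_{n-1}^m` with the edge `{m, n}` deleted is `K_{n-1}^{m-1}`. -/
lemma completeAdd_deleteEdges {n m : ℕ} (hm : 1 ≤ m) :
    (completeAdd n m).deleteEdges {toLex (m, n)} = completeAdd n (m - 1) := by
  have h : ∀ e : ℕ ×ₗ ℕ, e = toLex (m, n) ↔ (ofLex e).1 = m ∧ (ofLex e).2 = n :=
    fun e => Prod.ext_iff (x := ofLex e) (y := (m, n))
  refine Graph.ext rfl fun e u v => ?_
  simp only [completeAdd, deleteEdges_isLink, mem_ofPred_eq, mem_singleton_iff, h]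
  constructor
  · rintro ⟨⟨h1, h2⟩, h3⟩
    exact ⟨h1, by omega⟩
  · rintro ⟨h1, h2⟩
    exact ⟨⟨h1, by omega⟩, by omega⟩

lemma completeAdd_spanning {n m : ℕ} (hm : 1 ≤ m) : completeAdd n (m - 1) ≤s completeAdd n m where
  le := by
    rw [← completeAdd_deleteEdges hm]
    exact deleteEdges_le
  vertexSet_eq := rfl

/-- Deleting from the contraction of `{m, n}` in `K_{n-1}^m` the edges `{t, n}`, `t < m`, which are
parallel to the edges `{t, m}`, gives `K_{n-1}`. -/
lemma contract_deleteEdges {n m : ℕ} (hm : 1 ≤ m) (hmn : m < n) :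
    (contract (completeAdd n m) (toLex (m, n)) m n).deleteEdges {e | (ofLex e).2 = n} =
      complete (n - 1) := by
  have h : ∀ e : ℕ ×ₗ ℕ, e = toLex (m, n) ↔ (ofLex e).1 = m ∧ (ofLex e).2 = n :=
    fun e => Prod.ext_iff (x := ofLex e) (y := (m, n))
  have hc : contract (completeAdd n m) (toLex (m, n)) m n =
      ((completeAdd n m).deleteEdges {toLex (m, n)}).map (fun v => if v = n then m else v) := by
    unfold contract
    congr!
  rw [hc]
  refine Graph.ext ?_ fun e u v => ?_
  · change (fun v => if v = n then m else v) '' Icc 1 n = Icc 1 (n - 1)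
    ext v
    simp only [mem_image, mem_Icc]
    constructor
    · rintro ⟨u, hu, rfl⟩
      split_ifs <;> omega
    · intro hv
      exact ⟨v, by omega, if_neg (by omega)⟩
  · change ((∃ a b, (((1 ≤ (ofLex e).1 ∧ (ofLex e).1 < (ofLex e).2 ∧ (ofLex e).2 ≤ n ∧
      (((ofLex e).1 = a ∧ (ofLex e).2 = b) ∨ ((ofLex e).1 = b ∧ (ofLex e).2 = a))) ∧
      ¬ ((ofLex e).2 = n ∧ m < (ofLex e).1)) ∧ e ∉ ({toLex (m, n)} : Set (ℕ ×ₗ ℕ))) ∧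
      (if a = n then m else a) = u ∧ (if b = n then m else b) = v) ∧ ¬ (ofLex e).2 = n) ↔
      (1 ≤ (ofLex e).1 ∧ (ofLex e).1 < (ofLex e).2 ∧ (ofLex e).2 ≤ n - 1 ∧
      (((ofLex e).1 = u ∧ (ofLex e).2 = v) ∨ ((ofLex e).1 = v ∧ (ofLex e).2 = u)))
    rw [mem_singleton_iff, h]
    constructor
    · rintro ⟨⟨a, b, ⟨⟨⟨h1, h2, h3, h4⟩, -⟩, -⟩, h6, h7⟩, h8⟩
      rw [if_neg (by omega)] at h6 h7
      subst h6 h7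
      exact ⟨h1, h2, by omega, h4⟩
    · rintro ⟨h1, h2, h3, h4⟩
      exact ⟨⟨u, v, ⟨⟨⟨h1, h2, by omega, h4⟩, by omega⟩, by omega⟩,
        if_neg (by omega), if_neg (by omega)⟩, by omega⟩

lemma complete_spanning {n m : ℕ} (hm : 1 ≤ m) (hmn : m < n) :
    complete (n - 1) ≤s contract (completeAdd n m) (toLex (m, n)) m n where
  le := by
    rw [← contract_deleteEdges hm hmn]
    exact deleteEdges_le
  vertexSet_eq := by
    rw [← contract_deleteEdges hm hmn]
    rfl

end CompleteGraphs

end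

end ChromaticHomology

/-! The sequence of complexes `0 → C(G/e) → C(G) → C(G - e) → 0` is exact, so everything follows
from a left inverse of `α*` in every degree: `α*` is then injective, the connecting maps vanish,
`β*` is surjective and the sequence splits. Write `e = aw` with `a = m`, `w = n`, and let `K` be `G`
without the vertex `w`. Deleting parallel edges does not change homology, so `H(G/e) ≅ H(K)`, and it
suffices to find a chain map `ρ : C(G) → C(K)`, of degree `-1` in `i`, for which `ρ ∘ α` is the
deletion map `C(G/e) → C(K)`.

Each edge `g = uv` has an operator `h_g` (`splitEdge`): remove `g` with a sign, pull the colouring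
back along the addition of `g` in any way, and multiply by `x_u + x_v`. This does not depend on the
pullback (`mulX_add_mulX_eq`, `mulX_add_mulX_eq_zero`); when `g` joins distinct components it is the
comultiplication `1 ↦ 1⊗x + x⊗1`, `x ↦ x⊗x`. It satisfies `h_g d - d h_g = (-1)^i (x_u + x_v)`
(`Descends.signedDescend_d`). Around a closed walk `a, w, b, c` the alternating sum of the `x_u +
x_v` is zero, so the alternating sum of the `h_g` (`cycleMap`) commutes with `d`. It raises the
number of `x`'s by one. Next, `removeVertex` discards the states with edges outside `K` and applies
`1 ↦ 0`, `x ↦ 1` to the colour of the isolated vertex `w`; this is a chain map that loses one `x`.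
The composite is `ρ`.

Every state in the image of `α` contains `e`. The operators of the other three edges keep `e`, which
is not an edge of `K`, so their contribution is discarded. The operator of `e` removes `e`, and of
`x_a + x_w` only the term `x_w` colours the isolated vertex `w` by `x`; what remains is the original
state seen in `K` (`removeVertex_cycleMap_expandMap`). For `K_{n-1}^m` the walk is `m, n, 1, t`: it
needs `m ≥ 2` so that `{1, n}` is an edge other than `e`, and `n ≥ 4` so that a fourth vertex `t`
exists.

The deletion of parallel edges uses the same mechanism with the identity in place of `x_u + x_v`: if
`f` and `g` are parallel, then on states that contain `f` the addition of `g` merges nothing, so the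
removal of `g` is a contracting homotopy up to sign and the kernel of the deletion of `f` is
acyclic. -/

namespace ChromaticHomology

open Graph Set

noncomputable section

/-! ### Components under edge addition, and the homotopy operator of an edge -/

section Operators

variable {α β : Type*} {G H : Graph α β}

/-- A function on the vertices that is constant along the edges in `s` descends to the components
of `[G : s]`. -/
def compLift {X : Type*} {s : Finset β} (F : V(G) → X)
    (hF : ∀ u v : V(G), (G.restrict (s : Set β)).Adj u v → F u = F v) : Comp G s → X :=
  SimpleGraph.ConnectedComponent.lift F (by
    intro u v p _
    induction p with
    | nil => rfl
    | cons h p ih => exact (hF _ _ h.2).trans (ih (SimpleGraph.Walk.IsPath.of_cons ‹_›)))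

@[simp] lemma compLift_compOf {X : Type*} {s : Finset β} (F : V(G) → X) (hF) (v : V(G)) :
    compLift (s := s) F hF (compOf G s v) = F v := rfl

lemma compOf_eq_of_isLink {s : Finset β} {g : β} (hg : g ∈ s) {u v : V(G)} (h : G.IsLink g u v) :
    compOf G s u = compOf G s v :=
  compOf_eq_of_adj ⟨g, by simpa using hg, h⟩

lemma push_surjective {s t : Finset β} (h : s ⊆ t) : Function.Surjective (push (G := G) h) := by
  intro c
  obtain ⟨v, rfl⟩ := compOf_surjective _ c
  exact ⟨compOf G s v, rfl⟩

/-- Adding the edge `g = uv` merges at most the components of `u` and `v`. -/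
lemma push_insert_eq [DecidableEq β] {s t : Finset β} {g : β} {u v : V(G)} (hg : G.IsLink g u v)
    (ht : t = insert g s) (hst : s ⊆ t) {a b : Comp G s} (hab : push hst a = push hst b) :
    a = b ∨ (a = compOf G s u ∧ b = compOf G s v) ∨ (a = compOf G s v ∧ b = compOf G s u) := by
  classical
  -- The map `r` collapses the component of `v` onto that of `u`. It is compatible with all edges of
  -- `t`, so it induces `F` on the components of `[G : t]`, and `push` identifies no more than `r`
  -- does.
  let r : Comp G s → Comp G s := fun a => if a = compOf G s v then compOf G s u else a
  let F : Comp G t → Comp G s := compLift (fun w => r (compOf G s w)) (by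
    rintro a b ⟨f, hf, hl⟩
    subst ht
    rcases Finset.mem_insert.1 (Finset.mem_coe.1 hf) with rfl | hf
    · rcases hg.eq_and_eq_or_eq_and_eq hl with ⟨h1, h2⟩ | ⟨h1, h2⟩ <;>
        simp only [← Subtype.ext_iff] at h1 h2 <;> subst h1 h2 <;> simp [r]
    · rw [compOf_eq_of_isLink hf hl])
  have hF : ∀ a, F (push hst a) = r a := by
    intro a
    obtain ⟨w, rfl⟩ := compOf_surjective _ a
    rfl
  have h := congrArg F hab
  rw [hF, hF] at h
  simp only [r] at h
  split_ifs at h with h1 h2 h2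
  · exact Or.inl (h1.trans h2.symm)
  · exact Or.inr (Or.inr ⟨h1, h.symm⟩)
  · exact Or.inr (Or.inl ⟨h, h2⟩)
  · exact Or.inl h

/-! ### Iterated extensions -/

lemma State.extend_eq_single (S : State G) {t : Finset β} (h : S.edges ⊆ t)
    (ht : (t : Set β) ⊆ E(G)) (hi : InjOn (push (G := G) h) S.colX) :
    S.extend t = Finsupp.single ⟨t, ht, push h '' S.colX⟩ 1 := by
  rw [State.extend, dif_pos ⟨h, ht⟩, if_pos hi]

lemma State.extend_eq_zero (S : State G) {t : Finset β} (h : S.edges ⊆ t)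
    (hi : ¬ InjOn (push (G := G) h) S.colX) : S.extend t = 0 := by
  rw [State.extend]
  split_ifs with h1
  · rfl
  · rfl

lemma State.extend_cases (S : State G) (t : Finset β) :
    S.extend t = 0 ∨ ∃ (h : S.edges ⊆ t) (ht : (t : Set β) ⊆ E(G)),
      InjOn (push (G := G) h) S.colX ∧
      S.extend t = Finsupp.single ⟨t, ht, push h '' S.colX⟩ 1 := by
  rw [State.extend]
  split_ifs with h1 h2
  · exact Or.inr ⟨h1.1, h1.2, h2, rfl⟩
  · exact Or.inl rfl
  · exact Or.inl rfl

lemma State.extend_eq_single_iff (S T : State G) (t : Finset β) :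
    S.extend t = Finsupp.single T 1 ↔ ∃ (h : S.edges ⊆ t) (ht : (t : Set β) ⊆ E(G)),
      InjOn (push (G := G) h) S.colX ∧ T = ⟨t, ht, push h '' S.colX⟩ := by
  constructor
  · intro h
    rcases S.extend_cases t with h0 | ⟨h1, h2, h3, h4⟩
    · rw [h0] at h
      exact absurd h.symm (by simp)
    · rw [h4] at h
      exact ⟨h1, h2, h3, (Finsupp.single_left_injective one_ne_zero h).symm⟩
  · rintro ⟨h, ht, hi, rfl⟩
    exact S.extend_eq_single h ht hi

/-- Multiplication of colours is associative, so edges may be added in two stages. The dichotomy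
records whether the product already vanishes at `t`. -/
lemma State.extend_trans (S : State G) {t r : Finset β} (h : S.edges ⊆ t)
    (hr : t ⊆ r) (hrE : (r : Set β) ⊆ E(G)) :
    (S.extend t = 0 ∧ S.extend r = 0) ∨
    ∃ T : State G, T.edges = t ∧ S.extend t = Finsupp.single T 1 ∧ S.extend r = T.extend r := by
  have ht : (t : Set β) ⊆ E(G) := (Finset.coe_subset.2 hr).trans hrE
  have hcomp : push (G := G) (h.trans hr) = push hr ∘ push h :=
    funext fun c => (push_push h hr c).symm
  by_cases hi : InjOn (push (G := G) h) S.colX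
  · refine Or.inr ⟨_, rfl, S.extend_eq_single h ht hi, ?_⟩
    by_cases hj : InjOn (push (G := G) hr) (push h '' S.colX)
    · rw [State.extend_eq_single (h := h.trans hr) (ht := hrE),
        State.extend_eq_single (h := hr) (ht := hrE)]
      · simp only [hcomp, image_comp]
      · exact hj
      · rw [hcomp]; exact hj.comp hi (mapsTo_image _ _)
    · rw [State.extend_eq_zero (h := h.trans hr), State.extend_eq_zero (h := hr)]
      · exact hj
      · rw [hcomp]; exact fun hc => hj hc.image_of_comp
  · refine Or.inl ⟨S.extend_eq_zero h hi, S.extend_eq_zero (h.trans hr) ?_⟩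
    rw [hcomp]
    exact fun hc => hi fun a ha b hb hab => hc ha hb (congrArg (push hr) hab)

/-- Choosing one component of `[G : s]` inside each component coloured `x`, and colouring only these
by `x`, gives a preimage. This is what allows an operator that removes edges to be defined by
pulling back. -/
lemma State.exists_extend_eq_single (T : State G) {s : Finset β} (hs : s ⊆ T.edges) :
    ∃ S : State G, S.edges = s ∧ S.extend T.edges = Finsupp.single T 1 := by
  have hsur := push_surjective (G := G) hs
  have hinv := Function.surjInv_eq hsur
  refine ⟨⟨s, (Finset.coe_subset.2 hs).trans T.edges_subset,
    Function.surjInv hsur '' T.colX⟩, rfl, ?_⟩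
  rw [State.extend_eq_single_iff]
  refine ⟨hs, T.edges_subset, ?_, ?_⟩
  · rintro _ ⟨a, -, rfl⟩ _ ⟨b, -, rfl⟩ hab
    rw [hinv, hinv] at hab
    rw [hab]
  · obtain ⟨t, ht, c⟩ := T
    simp only [State.mk.injEq, heq_eq_eq, true_and]
    simp only [image_image, hinv, image_id']

/-! ### Multiplication by `x` at a vertex -/

open Classical in
/-- Multiplication by `x` of the colour of the component that contains the vertex `v`. -/
def mulX (v : V(G)) : Chains G →ₗ[ℤ] Chains G :=
  Finsupp.linearCombination ℤ fun S =>
    if compOf G S.edges v ∈ S.colX then 0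
    else Finsupp.single ⟨S.edges, S.edges_subset, insert (compOf G S.edges v) S.colX⟩ 1

lemma mulX_single_of_mem {v : V(G)} {S : State G} (h : compOf G S.edges v ∈ S.colX) :
    mulX v (Finsupp.single S 1) = 0 := by
  simp [mulX, h]

lemma mulX_single_of_notMem {v : V(G)} {S : State G} (h : compOf G S.edges v ∉ S.colX) :
    mulX v (Finsupp.single S 1) =
      Finsupp.single ⟨S.edges, S.edges_subset, insert (compOf G S.edges v) S.colX⟩ 1 := by
  simp [mulX, h]

lemma mulX_extend_of_mem {v : V(G)} {S : State G} (h : compOf G S.edges v ∈ S.colX)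
    (t : Finset β) : mulX v (S.extend t) = 0 := by
  rcases S.extend_cases t with h0 | ⟨h1, h2, h3, h4⟩
  · rw [h0, map_zero]
  · rw [h4]
    exact mulX_single_of_mem ⟨_, h, rfl⟩

/-- Multiplication by `x` at `v` may be done before or after merging. If the component of `v` meets
another `x` on the way to `t`, both sides vanish. -/
lemma mulX_extend_of_notMem {v : V(G)} {S : State G} (h : compOf G S.edges v ∉ S.colX)
    (t : Finset β) : mulX v (S.extend t) =
      State.extend ⟨S.edges, S.edges_subset, insert (compOf G S.edges v) S.colX⟩ t := by
  by_cases hst : S.edges ⊆ t ∧ (t : Set β) ⊆ E(G)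
  swap
  · rw [State.extend, dif_neg hst, State.extend, dif_neg hst, map_zero]
  obtain ⟨hst, ht⟩ := hst
  have hins : InjOn (push (G := G) hst) (insert (compOf G S.edges v) S.colX) ↔
      InjOn (push hst) S.colX ∧ compOf G t v ∉ push hst '' S.colX := injOn_insert h
  let S' : State G := ⟨S.edges, S.edges_subset, insert (compOf G S.edges v) S.colX⟩
  change _ = S'.extend t
  by_cases hi : InjOn (push (G := G) hst) S.colX
  · rw [S.extend_eq_single hst ht hi]
    by_cases hv : compOf G t v ∈ push hst '' S.colX
    · rw [mulX_single_of_mem hv, S'.extend_eq_zero hst]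
      exact fun h' => (hins.1 h').2 hv
    · rw [mulX_single_of_notMem hv, S'.extend_eq_single hst ht (hins.2 ⟨hi, hv⟩)]
      simp only [S', image_insert_eq, push_compOf]
  · rw [S.extend_eq_zero hst hi, map_zero, S'.extend_eq_zero hst]
    exact fun h' => hi (hins.1 h').1

/-- Only `U` and `V` can be identified by `p`, so `c₁` and `c₂` agree elsewhere, and neither
contains both points if these are distinct. Two unequal sets with the same image therefore differ by
moving one point between `U` and `V`, and they become equal once both points are put in. -/
lemma eq_or_eq_swap_of_image_eq {A B : Type*} {p : A → B} {U V : A} (hUV : p U = p V)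
    (hfib : ∀ a b, p a = p b → a = b ∨ (a = U ∧ b = V) ∨ (a = V ∧ b = U)) {c₁ c₂ : Set A}
    (h₁ : InjOn p c₁) (h₂ : InjOn p c₂) (h : p '' c₁ = p '' c₂) :
    c₁ = c₂ ∨ (U ∈ c₁ ∧ V ∉ c₁ ∧ V ∈ c₂ ∧ U ∉ c₂ ∧ insert V c₁ = insert U c₂) ∨
      (V ∈ c₁ ∧ U ∉ c₁ ∧ U ∈ c₂ ∧ V ∉ c₂ ∧ insert U c₁ = insert V c₂) := by
  have key : ∀ d₁ d₂ : Set A, p '' d₁ = p '' d₂ → ∀ a ∈ d₁,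
      a ∈ d₂ ∨ (a = U ∧ V ∈ d₂) ∨ (a = V ∧ U ∈ d₂) := by
    intro d₁ d₂ h a ha
    obtain ⟨b, hb, hba⟩ : p a ∈ p '' d₂ := h ▸ ⟨a, ha, rfl⟩
    rcases hfib a b hba.symm with rfl | ⟨rfl, rfl⟩ | ⟨rfl, rfl⟩ <;> simp [hb]
  have k₁ := key _ _ h
  have k₂ := key _ _ h.symm
  have n₁ : U ∈ c₁ → V ∈ c₁ → U = V := fun hU hV => h₁ hU hV hUV
  have n₂ : U ∈ c₂ → V ∈ c₂ → U = V := fun hU hV => h₂ hU hV hUV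
  clear h hUV hfib h₁ h₂ key
  have e : ∀ a, a ≠ U → a ≠ V → (a ∈ c₁ ↔ a ∈ c₂) := by grind
  by_cases hU : (U ∈ c₁ ↔ U ∈ c₂)
  · left
    have hV : (V ∈ c₁ ↔ V ∈ c₂) := by grind
    ext a; grind
  · right
    by_cases hU1 : U ∈ c₁
    · left
      refine ⟨hU1, by grind, by grind, by grind, ?_⟩
      ext a; simp only [mem_insert_iff]; grind
    · right
      refine ⟨by grind, hU1, by grind, by grind, ?_⟩
      ext a; simp only [mem_insert_iff]; grind

/-- The colours of the components of `u` and `v` may be moved across an edge `g = uv` after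
multiplication by `x_u + x_v`. -/
lemma mulX_add_mulX_eq [DecidableEq β] {g : β} {u v : V(G)} (hg : G.IsLink g u v)
    {S₁ S₂ T : State G} (h₁ : g ∉ S₁.edges) (h₂ : g ∉ S₂.edges)
    (hT₁ : S₁.extend (insert g S₁.edges) = Finsupp.single T 1)
    (hT₂ : S₂.extend (insert g S₂.edges) = Finsupp.single T 1) :
    (mulX u + mulX v) (Finsupp.single S₁ 1) = (mulX u + mulX v) (Finsupp.single S₂ 1) := by
  obtain ⟨hs₁, ht₁, hi₁, rfl⟩ := (S₁.extend_eq_single_iff _ _).1 hT₁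
  obtain ⟨hs₂, ht₂, hi₂, hT⟩ := (S₂.extend_eq_single_iff _ _).1 hT₂
  obtain ⟨s₁, hE₁, c₁⟩ := S₁
  obtain ⟨s₂, hE₂, c₂⟩ := S₂
  have hs : s₁ = s₂ := by
    have := congrArg (fun S : State G => S.edges.erase g) hT
    simpa [Finset.erase_insert h₁, Finset.erase_insert h₂] using this
  subst hs
  simp only [State.mk.injEq, heq_eq_eq, true_and] at hT hi₁ hi₂
  have huv : push hs₁ (compOf G s₁ u) = push hs₁ (compOf G s₁ v) :=
    compOf_eq_of_isLink (by simp) hg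
  -- If one pullback colours the component of `u` and the other that of `v`, then `x_u + x_v` sends
  -- each to the state in which both are coloured `x`: in each case one summand dies by `x² = 0` and
  -- the other supplies the missing `x`.
  rcases eq_or_eq_swap_of_image_eq huv
    (fun a b => push_insert_eq hg rfl hs₁ (a := a) (b := b)) hi₁ hi₂ hT with
    rfl | ⟨a1, a2, a3, a4, a5⟩ | ⟨a1, a2, a3, a4, a5⟩
  · rfl
  · rw [LinearMap.add_apply, LinearMap.add_apply, mulX_single_of_mem a1,
      mulX_single_of_notMem a2, mulX_single_of_notMem a4, mulX_single_of_mem a3, zero_add, add_zero]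
    simp only [a5]
  · rw [LinearMap.add_apply, LinearMap.add_apply, mulX_single_of_notMem a2,
      mulX_single_of_mem a1, mulX_single_of_mem a3, mulX_single_of_notMem a4, zero_add, add_zero]
    simp only [a5]

/-- The extension by `g` can vanish only if the components of `u` and `v` are distinct and both
coloured `x`, and then `x_u` and `x_v` each annihilate the state. -/
lemma mulX_add_mulX_eq_zero [DecidableEq β] {g : β} {u v : V(G)} (hg : G.IsLink g u v)
    {S : State G} (h : S.extend (insert g S.edges) = 0) :
    (mulX u + mulX v) (Finsupp.single S 1) = 0 := by
  have hs : S.edges ⊆ insert g S.edges := Finset.subset_insert _ _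
  have hi : ¬ InjOn (push (G := G) hs) S.colX := by
    intro hi
    have ht : ((insert g S.edges : Finset β) : Set β) ⊆ E(G) := by
      rw [Finset.coe_insert]
      exact Set.insert_subset hg.edge_mem S.edges_subset
    rw [S.extend_eq_single hs ht hi] at h
    simp at h
  simp only [InjOn, not_forall] at hi
  obtain ⟨a, ha, b, hb, hab, hne⟩ := hi
  have : compOf G S.edges u ∈ S.colX ∧ compOf G S.edges v ∈ S.colX := by
    rcases push_insert_eq hg rfl hs hab with h | ⟨rfl, rfl⟩ | ⟨rfl, rfl⟩
    · exact absurd h hne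
    · exact ⟨ha, hb⟩
    · exact ⟨hb, ha⟩
  rw [LinearMap.add_apply, mulX_single_of_mem this.1, mulX_single_of_mem this.2, add_zero]

lemma mulX_d [LinearOrder β] [Finite E(G)] (v : V(G)) (z : Chains G) :
    mulX v (d G z) = d G (mulX v z) := by
  suffices h : mulX v ∘ₗ d G = d G ∘ₗ mulX v from LinearMap.congr_fun h z
  refine Finsupp.lhom_ext' fun S => LinearMap.ext_ring ?_
  simp only [LinearMap.comp_apply, Finsupp.lsingle_apply, d_single]
  rw [State.boundary, map_sum]
  by_cases h : compOf G S.edges v ∈ S.colX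
  · rw [mulX_single_of_mem h, map_zero]
    exact Finset.sum_eq_zero fun e _ => by rw [map_smul, mulX_extend_of_mem h, smul_zero]
  · rw [mulX_single_of_notMem h, d_single, State.boundary]
    exact Finset.sum_congr rfl fun e _ => by rw [map_smul, mulX_extend_of_notMem h]

lemma mulX_mem_cochains [Finite V(G)] (v : V(G)) {i : ℤ} {J : Set ℕ} {z : Chains G}
    (hz : z ∈ cochains G i J) : mulX v z ∈ cochains G i ((· + 1) '' J) := by
  rw [cochains, Finsupp.supported_eq_span_single] at hz
  refine Submodule.span_le (p := (cochains G i ((· + 1) '' J)).comap (mulX v)) |>.2 ?_ hz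
  rintro _ ⟨S, ⟨hS, hJ⟩, rfl⟩
  simp only [SetLike.mem_coe, Submodule.mem_comap]
  by_cases h : compOf G S.edges v ∈ S.colX
  · rw [mulX_single_of_mem h]
    exact zero_mem _
  · rw [mulX_single_of_notMem h]
    -- An infinite set has `ncard` zero, so the count goes up by one only because there are finitely
    -- many components.
    have : Finite (Comp G S.edges) := Finite.of_surjective _ (compOf_surjective S.edges)
    exact Finsupp.single_mem_supported ℤ _
      ⟨hS, _, hJ, (ncard_insert_of_notMem h (Set.toFinite _)).symm⟩

/-! ### Removing an edge -/

open Classical in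
/-- If `M` does not depend on the way in which a state is pulled back along the addition of the
edge `g`, then this is the map that removes `g` and applies `M`, restricted to the states that are
extensions of states whose edge set satisfies `Q`. -/
def descend [DecidableEq β] (g : β) (Q : Finset β → Prop) (M : Chains G →ₗ[ℤ] Chains G) :
    Chains G →ₗ[ℤ] Chains G :=
  Finsupp.linearCombination ℤ fun T =>
    if h : ∃ S : State G, Q S.edges ∧ g ∉ S.edges ∧
      S.extend (insert g S.edges) = Finsupp.single T 1 then M (Finsupp.single h.choose 1) else 0

/-- The condition under which `descend g Q M` satisfies `descend_extend`. -/
structure Descends [DecidableEq β] (g : β) (Q : Finset β → Prop)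
    (M : Chains G →ₗ[ℤ] Chains G) : Prop where
  eq_zero : ∀ S : State G, Q S.edges → g ∉ S.edges → S.extend (insert g S.edges) = 0 →
    M (Finsupp.single S 1) = 0
  eq : ∀ S₁ S₂ T : State G, Q S₁.edges → Q S₂.edges → g ∉ S₁.edges → g ∉ S₂.edges →
    S₁.extend (insert g S₁.edges) = Finsupp.single T 1 →
    S₂.extend (insert g S₂.edges) = Finsupp.single T 1 →
    M (Finsupp.single S₁ 1) = M (Finsupp.single S₂ 1)

variable [LinearOrder β] {g : β} {Q : Finset β → Prop} {M : Chains G →ₗ[ℤ] Chains G}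

lemma descend_single_of_notMem {T : State G} (h : g ∉ T.edges) :
    descend g Q M (Finsupp.single T 1) = 0 := by
  rw [descend, Finsupp.linearCombination_single, one_smul, dif_neg]
  rintro ⟨S, -, -, h'⟩
  obtain ⟨_, _, _, rfl⟩ := (S.extend_eq_single_iff _ _).1 h'
  exact h (by simp)

lemma Descends.descend_extend (hM : Descends g Q M) {S : State G} (hQ : Q S.edges)
    (hg : g ∉ S.edges) :
    descend g Q M (S.extend (insert g S.edges)) = M (Finsupp.single S 1) := by
  rcases S.extend_cases (insert g S.edges) with h0 | ⟨h1, h2, h3, h4⟩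
  · rw [h0, map_zero, hM.eq_zero S hQ hg h0]
  · rw [h4]
    have hex : ∃ S' : State G, Q S'.edges ∧ g ∉ S'.edges ∧
        S'.extend (insert g S'.edges) = Finsupp.single ⟨_, h2, push h1 '' S.colX⟩ 1 :=
      ⟨S, hQ, hg, h4⟩
    rw [descend, Finsupp.linearCombination_single, one_smul, dif_pos hex]
    exact hM.eq _ _ _ hex.choose_spec.1 hQ hex.choose_spec.2.1 hg hex.choose_spec.2.2 h4

lemma Descends.descend_extend_insert (hM : Descends g Q M) {S : State G} {t : Finset β}
    (hQ : Q t) (hg : g ∉ t) (hst : S.edges ⊆ t) (ht : ((insert g t : Finset β) : Set β) ⊆ E(G)) :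
    descend g Q M (S.extend (insert g t)) = M (S.extend t) := by
  rcases S.extend_trans hst (Finset.subset_insert g t) ht with ⟨h1, h2⟩ | ⟨T, rfl, h1, h2⟩
  · rw [h1, h2, map_zero, map_zero]
  · rw [h1, h2, hM.descend_extend hQ hg]

/-- The map `descend g Q M` with the sign of the edge `g`. -/
def signedDescend (g : β) (Q : Finset β → Prop) (M : Chains G →ₗ[ℤ] Chains G) :
    Chains G →ₗ[ℤ] Chains G :=
  Finsupp.linearCombination ℤ fun S =>
    (-1 : ℤ) ^ after S.edges g • descend g Q M (Finsupp.single S 1)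

lemma signedDescend_single (S : State G) : signedDescend g Q M (Finsupp.single S 1) =
    (-1 : ℤ) ^ after S.edges g • descend g Q M (Finsupp.single S 1) := by
  rw [signedDescend, Finsupp.linearCombination_single, one_smul]

lemma signedDescend_extend (S : State G) (t : Finset β) :
    signedDescend g Q M (S.extend t) = (-1 : ℤ) ^ after t g • descend g Q M (S.extend t) := by
  rcases S.extend_cases t with h0 | ⟨h1, h2, h3, h4⟩
  · rw [h0, map_zero, map_zero, smul_zero]
  · rw [h4, signedDescend_single]

lemma descend_extend_of_notMem {S : State G} {t : Finset β} (hg : g ∉ t) :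
    descend g Q M (S.extend t) = 0 := by
  rcases S.extend_cases t with h0 | ⟨h1, h2, h3, h4⟩
  · rw [h0, map_zero]
  · rw [h4, descend_single_of_notMem hg]

lemma before_add_after {s : Finset β} (hg : g ∉ s) : before s g + after s g = s.card := by
  rw [before, after, ← Finset.card_union_of_disjoint]
  · congr 1
    ext f
    simp only [Finset.mem_union, Finset.mem_filter]
    constructor
    · tauto
    · intro hf
      have : f ≠ g := fun h => hg (h ▸ hf)
      rcases lt_or_gt_of_ne this with h | h <;> tauto
  · rw [Finset.disjoint_left]
    intro f h1 h2
    exact lt_asymm (Finset.mem_filter.1 h1).2 (Finset.mem_filter.1 h2).2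

lemma exists_extend_insert_eq_single {S : State G} (hg : g ∈ S.edges) :
    ∃ S' : State G, g ∉ S'.edges ∧ S.edges = insert g S'.edges ∧
      S'.extend (insert g S'.edges) = Finsupp.single S 1 := by
  obtain ⟨S', h1, h2⟩ := S.exists_extend_eq_single (Finset.erase_subset g S.edges)
  have h3 : S.edges = insert g S'.edges := by rw [h1, Finset.insert_erase hg]
  exact ⟨S', by simp [h1], h3, h3 ▸ h2⟩

/-- The homotopy formula. If `g` is absent, only the term of `g` in the boundary survives the
removal of `g`. If `g` is present, the boundary after removal has one extra term, which puts `g`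
back. The sign counts the edges after `g`, not before it, so the remaining terms commute instead of
anticommuting. -/
lemma Descends.signedDescend_d [Finite E(G)] (hM : Descends g Q M) (hgE : g ∈ E(G))
    (hQi : ∀ s e, Q s → Q (insert e s)) (hQe : ∀ s, g ∉ s → Q (insert g s) → Q s)
    (hMd : ∀ z, M (d G z) = d G (M z)) {S : State G} (hQ : Q S.edges) :
    signedDescend g Q M (d G (Finsupp.single S 1)) =
      d G (signedDescend g Q M (Finsupp.single S 1)) +
        (-1 : ℤ) ^ S.edges.card • M (Finsupp.single S 1) := by
  by_cases hg : g ∈ S.edges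
  · obtain ⟨S', hg', hS, hS'⟩ := exists_extend_insert_eq_single hg
    have hQ' : Q S'.edges := hQe _ hg' (hS ▸ hQ)
    have hE : ((insert g S'.edges : Finset β) : Set β) ⊆ E(G) := hS ▸ S.edges_subset
    rw [signedDescend_single, hS, ← hS', hM.descend_extend hQ' hg',
      d_extend _ _ (Finset.subset_insert _ _) hE, map_sum, map_smul, ← hMd, d_single,
      State.boundary, map_sum, Finset.smul_sum]
    have hN : newEdges G S'.edges = insert g (newEdges G (insert g S'.edges)) := by
      ext f
      simp only [mem_newEdges, Finset.mem_insert]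
      by_cases hf : f = g
      · subst hf; simp [hgE, hg']
      · simp [hf]
    rw [hN, Finset.sum_insert (by simp [mem_newEdges]), add_comm, ← add_assoc]
    -- The extra term restores `g` with sign exponent `before + after = #S'.edges`, one less than
    -- the number of edges of the original state, so it cancels the term with `M`.
    have hzero : (-1 : ℤ) ^ (insert g S'.edges).card • M (S'.extend (insert g S'.edges)) +
        (-1 : ℤ) ^ after (insert g S'.edges) g • M ((-1 : ℤ) ^ before S'.edges g •
          S'.extend (insert g S'.edges)) = 0 := by
      rw [map_smul, smul_smul, ← add_smul]
      convert zero_smul ℤ _ using 2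
      rw [after_insert hg', if_neg (lt_irrefl _), add_zero, ← pow_add, add_comm (after _ _),
        before_add_after hg', Finset.card_insert_of_notMem hg']
      ring
    rw [hzero, zero_add]
    refine Finset.sum_congr rfl fun e he => ?_
    simp only [mem_newEdges, Finset.mem_insert, not_or] at he
    obtain ⟨heE, heg, heS⟩ := he
    rw [map_smul, map_smul, signedDescend_extend, Finset.insert_comm,
      hM.descend_extend_insert (hQi _ _ hQ') (by simp [hg', Ne.symm heg])
        (Finset.subset_insert _ _)
        (insert_subset_edgeSet (insert_subset_edgeSet S'.edges_subset heE) hgE),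
      smul_smul, smul_smul]
    congr 1
    rw [before_insert hg', after_insert (by simp [hg', Ne.symm heg]), after_insert hg',
      after_insert heS, if_neg (lt_irrefl _)]
    split_ifs <;> ring
  · rw [signedDescend_single, descend_single_of_notMem hg, smul_zero, map_zero, zero_add,
      d_single, State.boundary, map_sum, Finset.sum_eq_single g]
    · rw [map_smul, signedDescend_extend, hM.descend_extend hQ hg, smul_smul, ← pow_add,
        after_insert hg, if_neg (lt_irrefl _), add_zero, before_add_after hg]
    · intro e _ he
      rw [map_smul, signedDescend_extend, descend_extend_of_notMem (by simp [hg, he.symm]),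
        smul_zero, smul_zero]
    · intro h
      exact absurd (mem_newEdges.2 ⟨hgE, hg⟩) h

lemma Descends.signedDescend_mem_cochains (hM : Descends g Q M)
    (hQe : ∀ s, g ∉ s → Q (insert g s) → Q s) {i i' : ℤ} (hi : i' + 1 = i) {J J' : Set ℕ}
    (hMJ : ∀ z ∈ cochains G i' J, M z ∈ cochains G i' J') {S : State G} (hQ : Q S.edges)
    (hS : Finsupp.single S 1 ∈ cochains G i J) :
    signedDescend g Q M (Finsupp.single S 1) ∈ cochains G i' J' := by
  rw [signedDescend_single]
  refine Submodule.smul_mem _ _ ?_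
  by_cases hg : g ∈ S.edges
  · obtain ⟨S', hg', hS₁, hS'⟩ := exists_extend_insert_eq_single hg
    rw [← hS', hM.descend_extend (hQe _ hg' (hS₁ ▸ hQ)) hg']
    refine hMJ _ (Finsupp.single_mem_supported ℤ _ ?_)
    have h := (Finsupp.mem_supported ℤ _).1 hS (by simp : S ∈ _)
    obtain ⟨h1, h2, h3, h4⟩ := (S'.extend_eq_single_iff _ _).1 hS'
    constructor
    · have := h.1
      rw [hS₁, Finset.card_insert_of_notMem hg'] at this
      push_cast at this
      omega
    · have := h.2
      rw [h4, h3.ncard_image] at this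
      exact this
  · rw [descend_single_of_notMem hg]
    exact zero_mem _

end Operators

/-! ### Deletion of parallel edges and its effect on homology -/

section Deletion

variable {α β : Type*} {G H K : Graph α β}

/-! ### Chain homotopies across an edge -/

lemma descends_mulX [DecidableEq β] {g : β} {u v : V(G)} (hg : G.IsLink g u v) :
    Descends g (fun _ => True) (mulX u + mulX v) where
  eq_zero _ _ _ h := mulX_add_mulX_eq_zero hg h
  eq _ _ _ _ _ h₁ h₂ h₃ h₄ := mulX_add_mulX_eq hg h₁ h₂ h₃ h₄

/-- The edge `f` already connects `u` and `v` in `[G : s]`, so the parallel edge `g` merges nothing.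
-/
lemma push_injective_of_parallel [DecidableEq β] {f g : β} {u v : α} (hf : G.IsLink f u v)
    (hg : G.IsLink g u v) {s t : Finset β} (hs : f ∈ s) (ht : t = insert g s) (hst : s ⊆ t) :
    Function.Injective (push (G := G) hst) := by
  intro a b hab
  have huv : compOf G s ⟨u, hf.left_mem⟩ = compOf G s ⟨v, hf.right_mem⟩ :=
    compOf_eq_of_isLink hs hf
  rcases push_insert_eq (u := ⟨u, hf.left_mem⟩) (v := ⟨v, hf.right_mem⟩) hg ht hst hab with
    h | ⟨h1, h2⟩ | ⟨h1, h2⟩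
  · exact h
  · rw [h1, h2, huv]
  · rw [h1, h2, huv]

/-- On states that contain `f` the addition of `g` is injective and never zero, so the pullback is
unique and no correction by `x_u + x_v` is needed. -/
lemma descends_id_of_parallel [DecidableEq β] {f g : β} {u v : α} (hf : G.IsLink f u v)
    (hg : G.IsLink g u v) : Descends g (fun s => f ∈ s) (LinearMap.id : Chains G →ₗ[ℤ] _) where
  eq_zero S hS _ h := by
    have hs : S.edges ⊆ insert g S.edges := Finset.subset_insert _ _
    have ht : ((insert g S.edges : Finset β) : Set β) ⊆ E(G) := by
      rw [Finset.coe_insert]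
      exact Set.insert_subset hg.edge_mem S.edges_subset
    rw [S.extend_eq_single hs ht (push_injective_of_parallel hf hg hS rfl hs).injOn] at h
    simp at h
  eq S₁ S₂ T hQ₁ _ h₁ h₂ hT₁ hT₂ := by
    obtain ⟨hs₁, ht₁, hi₁, rfl⟩ := (S₁.extend_eq_single_iff _ _).1 hT₁
    obtain ⟨hs₂, ht₂, hi₂, hT⟩ := (S₂.extend_eq_single_iff _ _).1 hT₂
    obtain ⟨s₁, hE₁, c₁⟩ := S₁
    obtain ⟨s₂, hE₂, c₂⟩ := S₂
    have hs : s₁ = s₂ := by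
      have := congrArg (fun S : State G => S.edges.erase g) hT
      simpa [Finset.erase_insert h₁, Finset.erase_insert h₂] using this
    subst hs
    simp only [State.mk.injEq, heq_eq_eq, true_and] at hT
    rw [(push_injective_of_parallel hf hg hQ₁ rfl hs₁).image_injective hT]

/-! ### Deletion and its section on chains -/

variable [LinearOrder β]

set_option linter.unusedSectionVars false

/-- The inclusion of the enhanced states of a spanning subgraph. -/
def State.include (h : H ≤s G) (S : State H) : State G :=
  ⟨S.edges, S.edges_subset.trans h.le.edgeSet_mono, delComp h S.edges '' S.colX⟩

/-- The inclusion of the chains of a spanning subgraph; it does not commute with the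
differentials. -/
def includeMap (h : H ≤s G) : Chains H →ₗ[ℤ] Chains G :=
  Finsupp.lmapDomain ℤ ℤ (State.include h)

@[simp] lemma includeMap_single (h : H ≤s G) (S : State H) :
    includeMap h (Finsupp.single S 1) = Finsupp.single (S.include h) 1 := by
  simp [includeMap]

lemma State.del_include (h : H ≤s G) (S : State H) :
    (S.include h).del h = Finsupp.single S 1 := by
  have hs : ((S.include h).edges : Set β) ⊆ E(H) := S.edges_subset
  rw [State.del, dif_pos hs]
  congr 1
  exact State.ext rfl (heq_of_eq
    (preimage_image_eq _ (delComp_bijective h S.edges_subset).1))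

lemma delMap_includeMap (h : H ≤s G) (z : Chains H) : delMap h (includeMap h z) = z := by
  suffices h' : delMap h ∘ₗ includeMap h = LinearMap.id from LinearMap.congr_fun h' z
  refine Finsupp.lhom_ext' fun S => LinearMap.ext_ring ?_
  simp [State.del_include]

lemma delMap_single_of_not_subset (h : H ≤s G) {S : State G} (hS : ¬ (S.edges : Set β) ⊆ E(H)) :
    delMap h (Finsupp.single S 1) = 0 := by
  rw [delMap_single, State.del, dif_neg hS]

lemma includeMap_delMap_single (h : H ≤s G) {S : State G} (hS : (S.edges : Set β) ⊆ E(H)) :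
    includeMap h (delMap h (Finsupp.single S 1)) = Finsupp.single S 1 := by
  rw [delMap_single, State.del, dif_pos hS, includeMap_single]
  congr 1
  exact State.ext rfl (heq_of_eq (image_preimage_eq _ (delComp_bijective h hS).2))

lemma includeMap_mem_cochains (h : H ≤s G) {i : ℤ} {J : Set ℕ} {z : Chains H}
    (hz : z ∈ cochains H i J) : includeMap h z ∈ cochains G i J := by
  rw [cochains, Finsupp.supported_eq_span_single] at hz
  refine Submodule.span_le (p := (cochains G i J).comap (includeMap h)) |>.2 ?_ hz
  rintro _ ⟨S, ⟨hS, hJ⟩, rfl⟩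
  simp only [SetLike.mem_coe, Submodule.mem_comap, includeMap_single]
  refine Finsupp.single_mem_supported ℤ _ ⟨hS, ?_⟩
  change (delComp h S.edges '' S.colX).ncard ∈ J
  rwa [ncard_image_of_injective _ (delComp_bijective h S.edges_subset).1]

/-- Two linear maps that agree on the enhanced states that do not lie in `H` agree on the kernel of
the deletion map. -/
lemma eq_of_delMap_eq_zero {M : Type*} [AddCommGroup M] (h : H ≤s G) {φ ψ : Chains G →ₗ[ℤ] M}
    (hφ : ∀ S : State G, ¬ (S.edges : Set β) ⊆ E(H) →
      φ (Finsupp.single S 1) = ψ (Finsupp.single S 1))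
    {z : Chains G} (hz : delMap h z = 0) : φ z = ψ z := by
  -- The difference vanishes on the states that do not lie in `H`, hence it factors through the
  -- deletion map.
  have key : (φ - ψ) = (φ - ψ) ∘ₗ includeMap h ∘ₗ delMap h := by
    refine Finsupp.lhom_ext' fun S => LinearMap.ext_ring ?_
    simp only [LinearMap.comp_apply, Finsupp.lsingle_apply]
    by_cases hS : (S.edges : Set β) ⊆ E(H)
    · rw [includeMap_delMap_single h hS]
    · rw [delMap_single_of_not_subset h hS, map_zero, map_zero, LinearMap.sub_apply, hφ S hS,
        sub_self]
  have := LinearMap.congr_fun key z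
  rwa [LinearMap.comp_apply, LinearMap.comp_apply, hz, map_zero, map_zero, LinearMap.sub_apply,
    sub_eq_zero] at this

lemma delMap_trans (h₁ : H ≤s K) (h₂ : K ≤s G) (h : H ≤s G) (z : Chains G) :
    delMap h₁ (delMap h₂ z) = delMap h z := by
  suffices h' : delMap h₁ ∘ₗ delMap h₂ = delMap h from LinearMap.congr_fun h' z
  refine Finsupp.lhom_ext' fun S => LinearMap.ext_ring ?_
  simp only [LinearMap.comp_apply, Finsupp.lsingle_apply, delMap_single]
  by_cases hS : (S.edges : Set β) ⊆ E(H)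
  · rw [State.del, dif_pos (hS.trans h₁.le.edgeSet_mono), State.del, dif_pos hS, delMap_single,
      State.del, dif_pos hS]
    congr 1
    refine State.ext rfl (heq_of_eq ?_)
    ext c
    obtain ⟨v, rfl⟩ := compOf_surjective _ c
    rfl
  · rw [State.del, State.del, dif_neg hS]
    split_ifs with h'
    · rw [delMap_single, State.del, dif_neg hS]
    · exact map_zero _

lemma delMap_refl (h : G ≤s G) (z : Chains G) : delMap h z = z := by
  suffices h' : delMap h = LinearMap.id from LinearMap.congr_fun h' z
  refine Finsupp.lhom_ext' fun S => LinearMap.ext_ring ?_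
  simp only [LinearMap.comp_apply, Finsupp.lsingle_apply, delMap_single, LinearMap.id_apply]
  rw [State.del, dif_pos S.edges_subset]
  congr 1
  refine State.ext rfl (heq_of_eq ?_)
  ext c
  obtain ⟨v, rfl⟩ := compOf_surjective _ c
  rfl

/-! ### Maps on homology -/

lemma Homology.map_injective [Finite E(G)] [Finite E(H)] {φ : Chains G →ₗ[ℤ] Chains H} {hφ}
    {i i' : ℤ} {J : Set ℕ} {h0 h1}
    (h : ∀ z ∈ cocycles G i J, φ z ∈ coboundaries H i' J → z ∈ coboundaries G i J) :
    Function.Injective (Homology.map φ hφ i i' J h0 h1) := by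
  rw [injective_iff_map_eq_zero]
  intro c hc
  obtain ⟨⟨z, hz⟩, rfl⟩ := Submodule.Quotient.mk_surjective _ c
  have hc' : φ z ∈ coboundaries H i' J :=
    (Submodule.Quotient.mk_eq_zero ((coboundaries H i' J).submoduleOf (cocycles H i' J))).1 hc
  exact (Submodule.Quotient.mk_eq_zero _).2 (h z hz hc')

lemma Homology.map_surjective [Finite E(G)] [Finite E(H)] {φ : Chains G →ₗ[ℤ] Chains H} {hφ}
    {i i' : ℤ} {J : Set ℕ} {h0 h1}
    (h : ∀ w ∈ cocycles H i' J, ∃ z ∈ cocycles G i J, φ z = w) :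
    Function.Surjective (Homology.map φ hφ i i' J h0 h1) := by
  intro c
  obtain ⟨⟨w, hw⟩, rfl⟩ := Submodule.Quotient.mk_surjective _ c
  obtain ⟨z, hz, rfl⟩ := h w hw
  exact ⟨Submodule.Quotient.mk ⟨z, hz⟩, rfl⟩

/-- Multiplication by `(-1)^i` on chains of degree `i`. -/
def parity (G : Graph α β) : Chains G →ₗ[ℤ] Chains G :=
  Finsupp.linearCombination ℤ fun S => (-1 : ℤ) ^ S.edges.card • Finsupp.single S 1

lemma parity_single (S : State G) :
    parity G (Finsupp.single S 1) = (-1 : ℤ) ^ S.edges.card • Finsupp.single S 1 := by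
  simp only [parity, Finsupp.linearCombination_single, one_smul]

/-- The use of `natAbs` is harmless: there are no states in negative degree. -/
lemma parity_of_mem {i : ℤ} {J : Set ℕ} {z : Chains G} (hz : z ∈ cochains G i J) :
    parity G z = (-1 : ℤ) ^ i.natAbs • z := by
  rw [cochains, Finsupp.supported_eq_span_single] at hz
  refine LinearMap.eqOn_span (f := parity G) (g := (-1 : ℤ) ^ i.natAbs • LinearMap.id) ?_ hz
  rintro _ ⟨S, ⟨hS, -⟩, rfl⟩
  rw [parity_single, ← hS, Int.natAbs_natCast]
  rfl

/-- Deleting one of two parallel edges leaves an acyclic kernel. -/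
lemma exists_d_eq_of_parallel [Finite E(G)] (h : H ≤s G) {f g : β} {u v : α}
    (hf : G.IsLink f u v) (hg : G.IsLink g u v) (hfg : f ≠ g) (hE : E(H) = E(G) \ {f}) {i : ℤ}
    {J : Set ℕ} {z : Chains G} (hz : z ∈ cocycles G i J) (hz0 : delMap h z = 0) :
    ∃ y ∈ cochains G (i - 1) J, d G y = z ∧ delMap h y = 0 := by
  have hM := descends_id_of_parallel hf hg
  have hQe : ∀ s : Finset β, g ∉ s → f ∈ insert g s → f ∈ s := fun s _ hs =>
    (Finset.mem_insert.1 hs).resolve_left hfg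
  have hns : ∀ S : State G, ¬ (S.edges : Set β) ⊆ E(H) → f ∈ S.edges := by
    intro S hS
    by_contra hfS
    refine hS fun e he => hE ▸ ⟨S.edges_subset he, ?_⟩
    rintro rfl
    exact hfS he
  -- The kernel of the deletion of `f` is spanned by the states that contain `f`, and there the
  -- signed removal of `g` contracts it up to the sign `(-1)^i`.
  let k : Chains G →ₗ[ℤ] Chains G :=
    signedDescend g (fun s => f ∈ s) LinearMap.id
  have h1 : (k ∘ₗ d G) z = (d G ∘ₗ k + parity G) z := by
    refine eq_of_delMap_eq_zero h (fun S hS => ?_) hz0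
    have := hM.signedDescend_d hg.edge_mem (fun s e hs => Finset.mem_insert_of_mem hs) hQe
      (fun _ => rfl) (hns S hS)
    rw [LinearMap.add_apply, parity_single]
    exact this
  have hk : k z ∈ cochains G (i - 1) J := by
    have hzc := hz.1
    -- This projection onto the kernel of the deletion map fixes `z` and kills the states of `H`, so
    -- the claim can be checked on single states that contain `f`.
    let P : Chains G →ₗ[ℤ] Chains G := LinearMap.id - includeMap h ∘ₗ delMap h
    have hPz : P z = z := by simp [P, hz0]
    rw [← hPz]
    rw [cochains, Finsupp.supported_eq_span_single] at hzc
    refine Submodule.span_le (p := (cochains G (i - 1) J).comap (k ∘ₗ P)) |>.2 ?_ hzc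
    rintro _ ⟨S, hS, rfl⟩
    simp only [SetLike.mem_coe, Submodule.mem_comap, LinearMap.comp_apply, P, LinearMap.sub_apply,
      LinearMap.id_apply]
    by_cases hSH : (S.edges : Set β) ⊆ E(H)
    · rw [includeMap_delMap_single h hSH, sub_self, map_zero]
      exact zero_mem _
    · rw [delMap_single_of_not_subset h hSH, map_zero, sub_zero]
      exact hM.signedDescend_mem_cochains hQe (sub_add_cancel i 1) (fun _ hw => hw) (hns S hSH)
        (Finsupp.single_mem_supported ℤ _ hS)
  have hk0 : delMap h (k z) = 0 := by
    refine eq_of_delMap_eq_zero h (φ := delMap h ∘ₗ k) (ψ := 0) (fun S hS => ?_) hz0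
    rw [LinearMap.comp_apply, LinearMap.zero_apply, signedDescend_single, map_smul]
    by_cases hgS : g ∈ S.edges
    · obtain ⟨S', hg', hS₁, hS'⟩ := exists_extend_insert_eq_single hgS
      have hfS' := hQe _ hg' (hS₁ ▸ hns S hS)
      rw [← hS', hM.descend_extend hfS' hg', LinearMap.id_apply, delMap_single_of_not_subset,
        smul_zero]
      exact fun h' => (hE ▸ h' (Finset.mem_coe.2 hfS')).2 rfl
    · rw [descend_single_of_notMem hgS, map_zero, smul_zero]
  have hd : d G z = 0 := hz.2
  rw [LinearMap.comp_apply, hd, map_zero, LinearMap.add_apply, LinearMap.comp_apply,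
    parity_of_mem hz.1] at h1
  -- As `d z = 0`, the homotopy formula reads `d (k z) + (-1)^i z = 0`.
  refine ⟨-((-1 : ℤ) ^ i.natAbs • k z), neg_mem (Submodule.smul_mem _ _ hk), ?_, by
    rw [map_neg, map_smul, hk0, smul_zero, neg_zero]⟩
  rw [map_neg, map_smul, eq_neg_of_add_eq_zero_left h1.symm, smul_neg, neg_neg, smul_smul,
    ← mul_pow]
  simp

/-- Deleting one of two parallel edges induces an isomorphism on homology. -/
lemma betaStar_bijective_of_parallel [Finite E(G)] [Finite E(H)] (h : H ≤s G) {f g : β} {u v : α}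
    (hf : G.IsLink f u v) (hg : G.IsLink g u v) (hfg : f ≠ g) (hE : E(H) = E(G) \ {f}) (i : ℤ)
    (J : Set ℕ) : Function.Bijective (betaStar h i J) := by
  constructor
  · refine Homology.map_injective fun z hz ⟨w, hw, hwz⟩ => ?_
    have hdw := includeMap_mem_cochains h hw
    obtain ⟨y, hy, hyz, hy0⟩ := exists_d_eq_of_parallel h hf hg hfg hE
      (z := z - d G (includeMap h w)) (i := i) (J := J)
      ⟨sub_mem hz.1 (d_mem_cochains (by ring) hdw), by
        have : d G z = 0 := hz.2
        simp [this, d_comp_d]⟩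
      (by rw [map_sub, ← d_delMap, delMap_includeMap, hwz, sub_self])
    exact ⟨y + includeMap h w, add_mem hy hdw, by rw [map_add, hyz, sub_add_cancel]⟩
  · refine Homology.map_surjective fun w hw => ?_
    -- The included `w` need not be a cocycle, but its boundary is a cocycle in the kernel, hence
    -- bounds some `y` there, and subtracting `y` corrects it.
    have hi := includeMap_mem_cochains h hw.1
    have hdw : d H w = 0 := hw.2
    have hd0 : delMap h (d G (includeMap h w)) = 0 := by
      rw [← d_delMap, delMap_includeMap, hdw]
    obtain ⟨y, hy, hyz, hy0⟩ := exists_d_eq_of_parallel h hf hg hfg hE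
      (z := d G (includeMap h w)) (i := i + 1) (J := J)
      ⟨d_mem_cochains rfl hi, d_comp_d _⟩ hd0
    rw [add_sub_cancel_right] at hy
    refine ⟨includeMap h w - y, ⟨sub_mem hi hy, ?_⟩, ?_⟩
    · change d G (_ - y) = 0
      rw [map_sub, hyz, sub_self]
    · rw [map_sub, hy0, sub_zero, delMap_includeMap]

lemma betaStar_trans [Finite E(G)] [Finite E(H)] [Finite E(K)] (h₁ : H ≤s K) (h₂ : K ≤s G)
    (h : H ≤s G) (i : ℤ) (J : Set ℕ) :
    betaStar h i J = betaStar h₁ i J ∘ₗ betaStar h₂ i J := by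
  refine LinearMap.ext fun c => ?_
  obtain ⟨⟨z, hz⟩, rfl⟩ := Submodule.Quotient.mk_surjective _ c
  exact congrArg Submodule.Quotient.mk (Subtype.ext (delMap_trans h₁ h₂ h z).symm)

/-- Deleting edges that are parallel to remaining edges induces an isomorphism on homology. -/
theorem betaStar_bijective [Finite E(H)] (N : ℕ) :
    ∀ (G : Graph α β) [Finite E(G)] (h : H ≤s G), (E(G) \ E(H)).ncard = N →
    (∀ f ∈ E(G) \ E(H), ∃ g ∈ E(H), ∃ u v, G.IsLink f u v ∧ G.IsLink g u v) →
    ∀ (i : ℤ) (J : Set ℕ), Function.Bijective (betaStar h i J) := by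
  induction N with
  | zero =>
    intro G _ h hN _ i J
    rw [ncard_eq_zero (Set.toFinite _), sdiff_eq_empty] at hN
    obtain rfl : H = G := h.ext_of_edgeSet (h.le.edgeSet_mono.antisymm hN)
    have : betaStar h i J = LinearMap.id := by
      refine LinearMap.ext fun c => ?_
      obtain ⟨⟨z, hz⟩, rfl⟩ := Submodule.Quotient.mk_surjective _ c
      exact congrArg Submodule.Quotient.mk (Subtype.ext (delMap_refl h z))
    rw [this]
    exact Function.bijective_id
  | succ N ih =>
    intro G _ h hN hp i J
    obtain ⟨f, hf⟩ : (E(G) \ E(H)).Nonempty := by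
      rw [← ncard_pos (Set.toFinite _)]
      omega
    obtain ⟨g, hg, u, v, hfl, hgl⟩ := hp f hf
    have hfg : f ≠ g := by rintro rfl; exact hf.2 hg
    have hK : E(G.deleteEdges {f}) = E(G) \ {f} := rfl
    have : Finite E(G.deleteEdges {f}) := (Set.toFinite E(G)).subset fun _ hf => hf.1
    have h₂ : G.deleteEdges {f} ≤s G := ⟨deleteEdges_le, rfl⟩
    have h₁ : H ≤s G.deleteEdges {f} := by
      refine ⟨⟨h.le.vertexSet_mono, fun e a b he => ⟨h.le.isLink_mono he, ?_⟩⟩, h.vertexSet_eq⟩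
      rintro rfl
      exact hf.2 he.edge_mem
    rw [betaStar_trans h₁ h₂ h]
    refine (ih _ h₁ ?_ ?_ i J).comp (betaStar_bijective_of_parallel h₂ hfl hgl hfg hK i J)
    · rw [hK, sdiff_sdiff_comm, ncard_sdiff_singleton_of_mem hf, hN, Nat.add_sub_cancel]
    · intro f' hf'
      obtain ⟨g', hg', u', v', hl, hl'⟩ := hp f' ⟨hf'.1.1, hf'.2⟩
      -- The parallel partner lies in `H`, so it is not the edge `f` just deleted and still serves
      -- for the smaller graph.
      refine ⟨g', hg', u', v', ⟨hl, hf'.1.2⟩, ⟨hl', ?_⟩⟩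
      rintro rfl
      exact hf.2 hg'

end Deletion

section VertexRemoval

variable {α β : Type*} {G H : Graph α β} {w : V(G)}

/-! ### Removing a vertex -/

/-- `H` is a subgraph of `G` that has all the vertices of `G` except `w`. -/
structure IsVertexRemoval (H G : Graph α β) (w : V(G)) : Prop where
  le : H ≤ G
  notMem : w.1 ∉ V(H)
  eq_or_mem : ∀ v : V(G), v = w ∨ v.1 ∈ V(H)

/-- For a subgraph `H` of `G`: the component of `[G : s]` that contains a given component of
`[H : s]`. -/
def subComp (h : H ≤ G) (s : Finset β) : Comp H s → Comp G s :=
  compMap (fun v => ⟨v.1, h.vertexSet_mono v.2⟩) (fun _ _ huv =>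
    compOf_eq_of_adj (huv.mono (restrict_mono_left h _)))

open Classical in
/-- The components of `[G : s]` are those of `[H : s]` and the one of the removed vertex. -/
def compToOption (h : IsVertexRemoval H G w) {s : Finset β} (hs : (s : Set β) ⊆ E(H)) :
    Comp G s → Option (Comp H s) :=
  compLift (fun v => if hv : v.1 ∈ V(H) then some (compOf H s ⟨v.1, hv⟩) else none) (by
    rintro u v ⟨f, hf, hl⟩
    have hl' := (h.le.isLink_iff (hs hf)).2 hl
    rw [dif_pos hl'.left_mem, dif_pos hl'.right_mem]
    exact congrArg some (compOf_eq_of_isLink (u := ⟨u.1, hl'.left_mem⟩)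
      (v := ⟨v.1, hl'.right_mem⟩) hf hl'))

namespace IsVertexRemoval

variable (h : IsVertexRemoval H G w) {s t : Finset β}
include h

lemma compToOption_subComp (hs : (s : Set β) ⊆ E(H)) (c : Comp H s) :
    compToOption h hs (subComp h.le s c) = some c := by
  obtain ⟨v, rfl⟩ := compOf_surjective _ c
  exact dif_pos v.2

lemma compToOption_compOf (hs : (s : Set β) ⊆ E(H)) :
    compToOption h hs (compOf G s w) = none := dif_neg h.notMem

lemma subComp_injective (hs : (s : Set β) ⊆ E(H)) : Function.Injective (subComp h.le s) := by
  intro a b hab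
  have := congrArg (compToOption h hs) hab
  rwa [h.compToOption_subComp, h.compToOption_subComp, Option.some_inj] at this

lemma subComp_ne (hs : (s : Set β) ⊆ E(H)) (c : Comp H s) : subComp h.le s c ≠ compOf G s w := by
  intro hc
  have := congrArg (compToOption h hs) hc
  rw [h.compToOption_subComp, h.compToOption_compOf] at this
  exact absurd this (by simp)

lemma eq_compOf_or (c : Comp G s) : c = compOf G s w ∨ ∃ c', c = subComp h.le s c' := by
  obtain ⟨v, rfl⟩ := compOf_surjective _ c
  rcases h.eq_or_mem v with rfl | hv
  · exact Or.inl rfl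
  · exact Or.inr ⟨compOf H s ⟨v.1, hv⟩, rfl⟩

lemma push_subComp (hst : s ⊆ t) (c : Comp H s) :
    push hst (subComp h.le s c) = subComp h.le t (push hst c) := by
  obtain ⟨v, rfl⟩ := compOf_surjective _ c
  rfl

/-- Edges of `H` never touch `w`, so all merging takes place among the components of `H`, while that
of `w` stays isolated. -/
lemma injOn_push_iff (hst : s ⊆ t) (ht : (t : Set β) ⊆ E(H)) (c : Set (Comp G s)) :
    InjOn (push hst) c ↔ InjOn (push hst) (subComp h.le s ⁻¹' c) := by
  have hs : (s : Set β) ⊆ E(H) := (Finset.coe_subset.2 hst).trans ht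
  constructor
  · intro hi a ha b hb hab
    refine h.subComp_injective hs (hi ha hb ?_)
    rw [h.push_subComp, h.push_subComp, hab]
  · intro hi a ha b hb hab
    rcases h.eq_compOf_or a with rfl | ⟨a, rfl⟩ <;> rcases h.eq_compOf_or b with rfl | ⟨b, rfl⟩
    · rfl
    · rw [h.push_subComp, push_compOf] at hab
      exact absurd hab.symm (h.subComp_ne ht _)
    · rw [h.push_subComp, push_compOf] at hab
      exact absurd hab (h.subComp_ne ht _)
    · rw [h.push_subComp, h.push_subComp] at hab
      rw [hi ha hb (h.subComp_injective ht hab)]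

lemma preimage_push_image (hst : s ⊆ t) (ht : (t : Set β) ⊆ E(H)) (c : Set (Comp G s)) :
    subComp h.le t ⁻¹' (push hst '' c) = push hst '' (subComp h.le s ⁻¹' c) := by
  ext a
  constructor
  · rintro ⟨b, hb, hba⟩
    rcases h.eq_compOf_or b with rfl | ⟨b, rfl⟩
    · exact absurd hba.symm (h.subComp_ne ht _)
    · rw [h.push_subComp] at hba
      exact ⟨b, hb, h.subComp_injective ht hba⟩
  · rintro ⟨b, hb, rfl⟩
    exact ⟨_, hb, h.push_subComp hst b⟩

lemma compOf_mem_push_image_iff (hst : s ⊆ t) (ht : (t : Set β) ⊆ E(H)) (c : Set (Comp G s)) :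
    compOf G t w ∈ push hst '' c ↔ compOf G s w ∈ c := by
  constructor
  · rintro ⟨b, hb, hbw⟩
    rcases h.eq_compOf_or b with rfl | ⟨b, rfl⟩
    · exact hb
    · rw [h.push_subComp] at hbw
      exact absurd hbw (h.subComp_ne ht _)
  · exact fun hc => ⟨_, hc, rfl⟩

end IsVertexRemoval

open Classical in
/-- The removal of the vertex `w` from an enhanced state in which `w` is isolated and coloured `x`;
all other enhanced states are sent to `0`. -/
def removeVertex (h : IsVertexRemoval H G w) : Chains G →ₗ[ℤ] Chains H :=
  Finsupp.linearCombination ℤ fun S =>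
    if hs : (S.edges : Set β) ⊆ E(H) ∧ compOf G S.edges w ∈ S.colX then
      Finsupp.single ⟨S.edges, hs.1, subComp h.le S.edges ⁻¹' S.colX⟩ 1
    else 0

variable (h : IsVertexRemoval H G w)

lemma removeVertex_single {S : State G} (hs : (S.edges : Set β) ⊆ E(H))
    (hw : compOf G S.edges w ∈ S.colX) : removeVertex h (Finsupp.single S 1) =
      Finsupp.single ⟨S.edges, hs, subComp h.le S.edges ⁻¹' S.colX⟩ 1 := by
  rw [removeVertex, Finsupp.linearCombination_single, one_smul, dif_pos ⟨hs, hw⟩]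

lemma removeVertex_single_eq_zero {S : State G}
    (hs : (S.edges : Set β) ⊆ E(H) → compOf G S.edges w ∉ S.colX) :
    removeVertex h (Finsupp.single S 1) = 0 := by
  rw [removeVertex, Finsupp.linearCombination_single, one_smul, dif_neg fun h' => hs h'.1 h'.2]

lemma removeVertex_extend_of_not_subset (S : State G) {t : Finset β}
    (ht : ¬ (t : Set β) ⊆ E(H)) : removeVertex h (S.extend t) = 0 := by
  rcases S.extend_cases t with h0 | ⟨h1, h2, h3, h4⟩
  · rw [h0, map_zero]
  · rw [h4, removeVertex_single_eq_zero h fun h' => absurd h' ht]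

lemma removeVertex_extend_of_notMem {S : State G} (hw : compOf G S.edges w ∉ S.colX)
    (t : Finset β) : removeVertex h (S.extend t) = 0 := by
  rcases S.extend_cases t with h0 | ⟨h1, h2, h3, h4⟩
  · rw [h0, map_zero]
  · rw [h4, removeVertex_single_eq_zero h fun ht => ?_]
    exact fun h' => hw ((h.compOf_mem_push_image_iff h1 ht _).1 h')

lemma removeVertex_extend {S : State G} (hs : (S.edges : Set β) ⊆ E(H))
    (hw : compOf G S.edges w ∈ S.colX) {t : Finset β} (ht : (t : Set β) ⊆ E(H)) :
    removeVertex h (S.extend t) =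
      State.extend ⟨S.edges, hs, subComp h.le S.edges ⁻¹' S.colX⟩ t := by
  by_cases hst : S.edges ⊆ t
  · have htG : (t : Set β) ⊆ E(G) := ht.trans h.le.edgeSet_mono
    set S' : State H := ⟨S.edges, hs, subComp h.le S.edges ⁻¹' S.colX⟩
    by_cases hi : InjOn (push (G := G) hst) S.colX
    · rw [S.extend_eq_single hst htG hi,
        S'.extend_eq_single hst ht ((h.injOn_push_iff hst ht _).1 hi),
        removeVertex_single h (S := ⟨t, htG, push hst '' S.colX⟩) ht ⟨_, hw, rfl⟩]
      congr 1
      exact State.ext rfl (heq_of_eq (h.preimage_push_image hst ht _))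
    · rw [S.extend_eq_zero hst hi, map_zero,
        S'.extend_eq_zero hst fun h' => hi ((h.injOn_push_iff hst ht _).2 h')]
  · simp only [State.extend]
    rw [dif_neg (fun h' => hst h'.1), dif_neg (fun h' => hst h'.1), map_zero]

lemma ncard_preimage_subComp [Finite V(G)] {s : Finset β} (hs : (s : Set β) ⊆ E(H))
    {c : Set (Comp G s)} (hw : compOf G s w ∈ c) :
    (subComp h.le s ⁻¹' c).ncard + 1 = c.ncard := by
  have : Finite (Comp G s) := Finite.of_surjective _ (compOf_surjective s)
  have hc : c = insert (compOf G s w) (subComp h.le s '' (subComp h.le s ⁻¹' c)) := by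
    ext a
    rw [mem_insert_iff]
    constructor
    · intro ha
      rcases h.eq_compOf_or a with rfl | ⟨a, rfl⟩
      · exact Or.inl rfl
      · exact Or.inr ⟨a, ha, rfl⟩
    · rintro (rfl | ⟨a, ha, rfl⟩)
      · exact hw
      · exact ha
  conv_rhs => rw [hc]
  rw [ncard_insert_of_notMem _ (Set.toFinite _),
    ncard_image_of_injective _ (h.subComp_injective hs)]
  rintro ⟨a, -, ha⟩
  exact h.subComp_ne hs a ha

/-- Exactly one `x` is lost, that of the removed vertex; this undoes the shift of `J` caused by
`mulX`. -/
lemma removeVertex_mem_cochains [Finite V(G)] {i : ℤ} {J : Set ℕ} {z : Chains G}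
    (hz : z ∈ cochains G i ((· + 1) '' J)) : removeVertex h z ∈ cochains H i J := by
  rw [cochains, Finsupp.supported_eq_span_single] at hz
  refine Submodule.span_le (p := (cochains H i J).comap (removeVertex h)) |>.2 ?_ hz
  rintro _ ⟨S, ⟨hS, j, hj, hJ⟩, rfl⟩
  simp only [SetLike.mem_coe, Submodule.mem_comap]
  by_cases hs : (S.edges : Set β) ⊆ E(H) ∧ compOf G S.edges w ∈ S.colX
  · rw [removeVertex_single h hs.1 hs.2]
    refine Finsupp.single_mem_supported ℤ _ ⟨hS, ?_⟩
    have := ncard_preimage_subComp h hs.1 hs.2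
    change (subComp h.le S.edges ⁻¹' S.colX).ncard ∈ J
    rw [← hJ] at this
    rwa [Nat.add_right_cancel this]
  · rw [removeVertex_single_eq_zero h fun h1 h2 => hs ⟨h1, h2⟩]
    exact zero_mem _

lemma removeVertex_mulX_of_not_subset (v : V(G)) {S : State G}
    (hs : ¬ (S.edges : Set β) ⊆ E(H)) : removeVertex h (mulX v (Finsupp.single S 1)) = 0 := by
  by_cases hv : compOf G S.edges v ∈ S.colX
  · rw [mulX_single_of_mem hv, map_zero]
  · rw [mulX_single_of_notMem hv]
    exact removeVertex_single_eq_zero h fun h' => absurd h' hs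

/-- The inclusion of an enhanced state of `H`, with the removed vertex isolated and coloured `1`. -/
def State.addVertex (S : State H) : State G :=
  ⟨S.edges, S.edges_subset.trans h.le.edgeSet_mono, subComp h.le S.edges '' S.colX⟩

lemma compOf_notMem_addVertex (S : State H) :
    compOf G S.edges w ∉ (S.addVertex h).colX := by
  rintro ⟨a, -, ha⟩
  exact h.subComp_ne S.edges_subset a ha

lemma removeVertex_mulX_addVertex (S : State H) :
    removeVertex h (mulX w (Finsupp.single (S.addVertex h) 1)) = Finsupp.single S 1 := by
  rw [mulX_single_of_notMem (S := S.addVertex h) (compOf_notMem_addVertex h S),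
    removeVertex_single h S.edges_subset (mem_insert _ _)]
  have key : subComp h.le S.edges ⁻¹'
      insert (compOf G S.edges w) (subComp h.le S.edges '' S.colX) = S.colX := by
    ext a
    rw [mem_preimage, mem_insert_iff, (h.subComp_injective S.edges_subset).mem_set_image]
    simp [h.subComp_ne S.edges_subset a]
  congr 1
  exact State.ext rfl (heq_of_eq key)

/-- Multiplication at another vertex leaves the isolated vertex `w` coloured `1`, and such states
are sent to `0`. -/
lemma removeVertex_mulX_addVertex_of_ne (S : State H) {v : V(G)} (hv : v ≠ w) :
    removeVertex h (mulX v (Finsupp.single (S.addVertex h) 1)) = 0 := by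
  by_cases hv' : compOf G (S.addVertex h).edges v ∈ (S.addVertex h).colX
  · rw [mulX_single_of_mem hv', map_zero]
  · rw [mulX_single_of_notMem hv', removeVertex_single_eq_zero h]
    intro _ hw
    rcases mem_insert_iff.1 hw with hw | hw
    · exact h.subComp_ne S.edges_subset
        (compOf H S.edges ⟨v.1, (h.eq_or_mem v).resolve_left hv⟩) hw.symm
    · exact compOf_notMem_addVertex h S hw

variable [LinearOrder β]

/-- On states with edges in `H` the vertex `w` is isolated and its colour is an inert tensor factor
`ℤ[x]/(x²)`, to which the functional `1 ↦ 0`, `x ↦ 1` is applied. Adding an edge outside `H` leads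
to states that are sent to `0`. -/
lemma d_removeVertex [Finite E(G)] [Finite E(H)] (z : Chains G) :
    d H (removeVertex h z) = removeVertex h (d G z) := by
  suffices h' : d H ∘ₗ removeVertex h = removeVertex h ∘ₗ d G from LinearMap.congr_fun h' z
  refine Finsupp.lhom_ext' fun S => LinearMap.ext_ring ?_
  simp only [LinearMap.comp_apply, Finsupp.lsingle_apply, d_single]
  rw [State.boundary, map_sum]
  simp only [map_smul]
  by_cases hs : (S.edges : Set β) ⊆ E(H)
  · by_cases hw : compOf G S.edges w ∈ S.colX
    · rw [removeVertex_single h hs hw, d_single, State.boundary]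
      refine Finset.sum_subset_zero_on_sdiff ?_ ?_ ?_
      · intro e he
        rw [mem_newEdges] at he ⊢
        exact ⟨h.le.edgeSet_mono he.1, he.2⟩
      · intro e he
        rw [Finset.mem_sdiff, mem_newEdges, mem_newEdges] at he
        rw [removeVertex_extend_of_not_subset, smul_zero]
        intro h'
        exact he.2 ⟨h' (by simp), he.1.2⟩
      · intro e he
        rw [mem_newEdges] at he
        rw [removeVertex_extend h hs hw (insert_subset_edgeSet hs he.1)]
    · rw [removeVertex_single_eq_zero h fun _ => hw, map_zero]
      exact (Finset.sum_eq_zero fun e _ => by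
        rw [removeVertex_extend_of_notMem h hw, smul_zero]).symm
  · rw [removeVertex_single_eq_zero h fun h' => absurd h' hs, map_zero]
    refine (Finset.sum_eq_zero fun e he => ?_).symm
    rw [removeVertex_extend_of_not_subset, smul_zero]
    intro h'
    exact hs (subset_trans (Finset.coe_subset.2 (Finset.subset_insert _ _)) h')

end VertexRemoval

section Contraction

variable {α β : Type*} {G H : Graph α β} {e : β} {x y : α}

/-! ### Contraction on chains -/

lemma State.notMem_of_contract (S : State (contract G e x y)) : e ∉ S.edges :=
  fun h => (S.edges_subset h).2 rfl

variable [LinearOrder β]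

lemma State.expand_injective (he : G.IsLink e x y) :
    Function.Injective (State.expand (G := G) he) := by
  intro S T hST
  have hS := S.notMem_of_contract
  have hT := T.notMem_of_contract
  obtain ⟨s, hs, c⟩ := S
  obtain ⟨t, ht, c'⟩ := T
  have hst : s = t := by
    have := congrArg (fun S : State G => S.edges.erase e) hST
    simpa [State.expand, Finset.erase_insert hS, Finset.erase_insert hT] using this
  subst hst
  simp only [State.expand, State.mk.injEq, heq_eq_eq, true_and] at hST
  rw [(contractComp_bijective he s).2.preimage_injective hST]

lemma State.exists_expand_eq (he : G.IsLink e x y) (S : State G) (heS : e ∈ S.edges) :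
    ∃ T : State (contract G e x y), T.expand he = S := by
  obtain ⟨s, hes, hs⟩ : ∃ s, e ∉ s ∧ S.edges = insert e s :=
    ⟨S.edges.erase e, Finset.notMem_erase _ _, (Finset.insert_erase heS).symm⟩
  obtain ⟨_, hE, c⟩ := S
  dsimp only at hs
  subst hs
  refine ⟨⟨s, fun f hf => ⟨hE (by simp [Finset.mem_coe.1 hf]), ?_⟩, contractComp he s '' c⟩, ?_⟩
  · rintro rfl
    exact hes hf
  · simp only [State.expand, preimage_image_eq _ (contractComp_bijective he s).1]

/-- Since `State.expand` is injective on states, every coefficient of `z` can be read off, up to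
sign, from its image; hence `α` is injective on chains. -/
lemma expandMap_apply_expand (he : G.IsLink e x y) (z : Chains (contract G e x y))
    (T : State (contract G e x y)) :
    expandMap he z (T.expand he) = (-1 : ℤ) ^ after T.edges e * z T := by
  classical
  suffices h : Finsupp.lapply (R := ℤ) (T.expand he) ∘ₗ expandMap he =
      (-1 : ℤ) ^ after T.edges e • Finsupp.lapply T from LinearMap.congr_fun h z
  refine Finsupp.lhom_ext' fun S => LinearMap.ext_ring ?_
  simp only [LinearMap.comp_apply, Finsupp.lsingle_apply, expandMap_single, Finsupp.lapply_apply,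
    LinearMap.smul_apply, Finsupp.smul_apply, Finsupp.single_apply,
    (State.expand_injective he).eq_iff]
  split_ifs with h
  · rw [h]
  · simp

lemma expandMap_injective (he : G.IsLink e x y) : Function.Injective (expandMap (G := G) he) := by
  rw [injective_iff_map_eq_zero]
  intro z hz
  ext T
  have h := expandMap_apply_expand he z T
  rw [hz, Finsupp.zero_apply, eq_comm, mul_eq_zero] at h
  exact h.resolve_left (pow_ne_zero _ (by norm_num))

lemma delMap_expandMap (he : G.IsLink e x y) (h : H ≤s G) (heH : e ∉ E(H))
    (z : Chains (contract G e x y)) : delMap h (expandMap he z) = 0 := by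
  suffices h' : delMap h ∘ₗ expandMap he = 0 from LinearMap.congr_fun h' z
  refine Finsupp.lhom_ext' fun S => LinearMap.ext_ring ?_
  rw [LinearMap.comp_apply, LinearMap.comp_apply, Finsupp.lsingle_apply, expandMap_single,
    map_smul, delMap_single_of_not_subset, smul_zero]
  · rfl
  · exact fun h' => heH (h' (Finset.mem_coe.2 (Finset.mem_insert_self e S.edges)))

/-- The chains of `G` that vanish after the deletion of `e` come from the contraction of `e`. -/
lemma exists_expandMap_eq (he : G.IsLink e x y) (h : H ≤s G) (hE : E(H) = E(G) \ {e}) {i i' : ℤ}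
    (hi : i + 1 = i') {J : Set ℕ} {z : Chains G} (hz : z ∈ cochains G i' J)
    (hz0 : delMap h z = 0) : ∃ y' ∈ cochains (contract G e x y) i J, expandMap he y' = z := by
  let P : Chains G →ₗ[ℤ] Chains G := LinearMap.id - includeMap h ∘ₗ delMap h
  have hPz : P z = z := by simp [P, hz0]
  change z ∈ (cochains (contract G e x y) i J).map (expandMap he)
  rw [← hPz]
  rw [cochains, Finsupp.supported_eq_span_single] at hz
  refine Submodule.span_le
    (p := ((cochains (contract G e x y) i J).map (expandMap he)).comap P) |>.2 ?_ hz
  rintro _ ⟨S, hS, rfl⟩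
  simp only [SetLike.mem_coe, Submodule.mem_comap, P, LinearMap.sub_apply,
    LinearMap.id_apply, LinearMap.comp_apply]
  by_cases hSH : (S.edges : Set β) ⊆ E(H)
  · rw [includeMap_delMap_single h hSH, sub_self]
    exact zero_mem _
  · rw [delMap_single_of_not_subset h hSH, map_zero, sub_zero]
    have heS : e ∈ S.edges := by
      by_contra heS
      refine hSH fun f hf => hE ▸ ⟨S.edges_subset hf, ?_⟩
      rintro rfl
      exact heS hf
    obtain ⟨T, rfl⟩ := S.exists_expand_eq he heS
    refine ⟨(-1 : ℤ) ^ after T.edges e • Finsupp.single T 1, Submodule.smul_mem _ _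
      (Finsupp.single_mem_supported ℤ _ ⟨?_, ?_⟩), ?_⟩
    · have := hS.1
      change ((insert e T.edges).card : ℤ) = i' at this
      rw [Finset.card_insert_of_notMem T.notMem_of_contract] at this
      push_cast at this
      omega
    · have hb := contractComp_bijective he T.edges
      have := hS.2
      change (contractComp he T.edges ⁻¹' T.colX).ncard ∈ J at this
      rwa [ncard_preimage_of_injective_subset_range hb.1 (by simp [hb.2.range_eq])] at this
    · rw [map_smul, expandMap_single, smul_smul, ← mul_pow]
      simp

end Contraction

/-! ### The retraction from a closed walk of length four, and the splitting -/

section Retraction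

variable {α β : Type*} {G H K : Graph α β} [LinearOrder β] {e : β}

/-! ### The homotopy operator of an edge -/

/-- The chain homotopy between multiplication by `x_u + x_v` and `0` for an edge `g = uv`: it
removes `g` and applies the comultiplication of `ℤ[x]/(x²)`. -/
def splitEdge (g : β) (u v : V(G)) : Chains G →ₗ[ℤ] Chains G :=
  signedDescend g (fun _ => True) (mulX u + mulX v)

lemma splitEdge_d [Finite E(G)] {g : β} {u v : V(G)} (hg : G.IsLink g u v) (S : State G) :
    splitEdge g u v (d G (Finsupp.single S 1)) = d G (splitEdge g u v (Finsupp.single S 1)) +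
      (-1 : ℤ) ^ S.edges.card • (mulX u + mulX v) (Finsupp.single S 1) :=
  (descends_mulX hg).signedDescend_d hg.edge_mem (fun _ _ _ => trivial) (fun _ _ _ => trivial)
    (fun z => by rw [LinearMap.add_apply, LinearMap.add_apply, mulX_d, mulX_d, map_add]) trivial

lemma splitEdge_mem_cochains [Finite V(G)] {g : β} {u v : V(G)} (hg : G.IsLink g u v) {i i' : ℤ}
    (hi : i' + 1 = i) {J : Set ℕ} {z : Chains G} (hz : z ∈ cochains G i J) :
    splitEdge g u v z ∈ cochains G i' ((· + 1) '' J) := by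
  rw [cochains, Finsupp.supported_eq_span_single] at hz
  refine Submodule.span_le
    (p := (cochains G i' ((· + 1) '' J)).comap (splitEdge g u v)) |>.2 ?_ hz
  rintro _ ⟨S, hS, rfl⟩
  exact (descends_mulX hg).signedDescend_mem_cochains (fun _ _ _ => trivial) hi
    (fun w hw => add_mem (mulX_mem_cochains u hw) (mulX_mem_cochains v hw)) trivial
    (Finsupp.single_mem_supported ℤ _ hS)

/-- The alternating sum of the homotopy operators of the edges of a closed walk of length four. -/
def cycleMap (g₁ g₂ g₃ g₄ : β) (a b c w : V(G)) : Chains G →ₗ[ℤ] Chains G :=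
  splitEdge g₁ a w - splitEdge g₂ w b + splitEdge g₃ b c - splitEdge g₄ c a

variable {g₁ g₂ g₃ g₄ : β} {a b c w : V(G)}

/-- The commutators with `d` are `±(x_u + x_v)` with a sign common to the four edges. Their
alternating sum telescopes to zero because the closed walk has even length. -/
lemma d_cycleMap [Finite E(G)] (h₁ : G.IsLink g₁ a w) (h₂ : G.IsLink g₂ w b)
    (h₃ : G.IsLink g₃ b c) (h₄ : G.IsLink g₄ c a) (z : Chains G) :
    d G (cycleMap g₁ g₂ g₃ g₄ a b c w z) = cycleMap g₁ g₂ g₃ g₄ a b c w (d G z) := by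
  suffices h : d G ∘ₗ cycleMap g₁ g₂ g₃ g₄ a b c w = cycleMap g₁ g₂ g₃ g₄ a b c w ∘ₗ d G from
    LinearMap.congr_fun h z
  refine Finsupp.lhom_ext' fun S => LinearMap.ext_ring ?_
  simp only [LinearMap.comp_apply, Finsupp.lsingle_apply, cycleMap, LinearMap.add_apply,
    LinearMap.sub_apply, map_add, map_sub, splitEdge_d h₁, splitEdge_d h₂, splitEdge_d h₃,
    splitEdge_d h₄, smul_add]
  abel

lemma cycleMap_mem_cochains [Finite V(G)] (h₁ : G.IsLink g₁ a w) (h₂ : G.IsLink g₂ w b)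
    (h₃ : G.IsLink g₃ b c) (h₄ : G.IsLink g₄ c a) {i i' : ℤ} (hi : i' + 1 = i) {J : Set ℕ}
    {z : Chains G} (hz : z ∈ cochains G i J) :
    cycleMap g₁ g₂ g₃ g₄ a b c w z ∈ cochains G i' ((· + 1) '' J) :=
  sub_mem (add_mem (sub_mem (splitEdge_mem_cochains h₁ hi hz) (splitEdge_mem_cochains h₂ hi hz))
    (splitEdge_mem_cochains h₃ hi hz)) (splitEdge_mem_cochains h₄ hi hz)

/-! ### The retraction -/

/-- Removing `g ≠ e` leaves `e` in the state, and states with an edge outside `K` are discarded. -/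
lemma removeVertex_splitEdge_of_ne (hK : IsVertexRemoval K G w) (heK : e ∉ E(K)) {g : β}
    (hge : g ≠ e) {u v : V(G)} (hg : G.IsLink g u v) {S : State G} (heS : e ∈ S.edges) :
    removeVertex hK (splitEdge g u v (Finsupp.single S 1)) = 0 := by
  rw [splitEdge, signedDescend_single, map_smul]
  by_cases hgS : g ∈ S.edges
  · obtain ⟨S', hg', hS₁, hS'⟩ := exists_extend_insert_eq_single hgS
    have heS' : e ∈ S'.edges := by
      rw [hS₁, Finset.mem_insert] at heS
      exact heS.resolve_left hge.symm
    have hns : ¬ (S'.edges : Set β) ⊆ E(K) := fun h' => heK (h' (Finset.mem_coe.2 heS'))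
    rw [← hS', (descends_mulX hg).descend_extend trivial hg', LinearMap.add_apply, map_add,
      removeVertex_mulX_of_not_subset hK _ hns, removeVertex_mulX_of_not_subset hK _ hns, add_zero,
      smul_zero]
  · rw [descend_single_of_notMem hgS, map_zero, smul_zero]

/-- Adding `e` joins `w`, coloured `1`, to the component of `a` and so changes no colour. This
provides a pullback along `e` in which `w` is isolated, on which `splitEdge` is easy to evaluate. -/
lemma extend_addVertex_eq_expand (he : G.IsLink e a w) (hK : IsVertexRemoval K G w)
    (hKC : K ≤s contract G e a w) (S : State (contract G e a w))
    (hS : (S.edges : Set β) ⊆ E(K)) :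
    (State.addVertex hK ⟨S.edges, hS, delComp hKC S.edges ⁻¹' S.colX⟩).extend (insert e S.edges) =
      Finsupp.single (S.expand he) 1 := by
  have hst : S.edges ⊆ insert e S.edges := Finset.subset_insert _ _
  let p : Comp K S.edges → Comp G (insert e S.edges) :=
    fun c => push hst (subComp hK.le S.edges c)
  -- The contraction moves only `w`, which is not a vertex of `K`.
  have hp : ∀ c, contractComp he S.edges (p c) = delComp hKC S.edges c := by
    intro c
    obtain ⟨v, rfl⟩ := compOf_surjective _ c
    refine congrArg (compOf _ _) (Subtype.ext (if_neg ?_))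
    intro hv
    exact hK.notMem (hv ▸ v.2)
  have hcb := contractComp_bijective he S.edges
  have hdb := delComp_bijective hKC hS
  have hpi : Function.Injective p := by
    intro c c' hcc
    apply hdb.1
    rw [← hp, ← hp, hcc]
  rw [State.extend_eq_single_iff]
  refine ⟨hst, expand_subset he S.edges_subset, ?_, ?_⟩
  · rintro _ ⟨c, -, rfl⟩ _ ⟨c', -, rfl⟩ hcc
    rw [hpi hcc]
  · refine State.ext rfl (heq_of_eq ?_)
    change contractComp he S.edges ⁻¹' S.colX =
      push hst '' (subComp hK.le S.edges '' (delComp hKC S.edges ⁻¹' S.colX))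
    rw [image_image]
    ext c
    constructor
    · intro hc
      obtain ⟨c', hc'⟩ := hdb.2 (contractComp he S.edges c)
      refine ⟨c', ?_, hcb.1 ((hp c').trans hc')⟩
      rw [mem_preimage, hc']
      exact hc
    · rintro ⟨c', hc', rfl⟩
      change contractComp he S.edges (p c') ∈ S.colX
      rw [hp]
      exact hc'

/-- The signs of `α` and of the removal of `e` are equal and cancel. On the pullback in which `w` is
isolated and coloured `1`, the term `x_w` is carried back to the state of `K` and the term `x_a` is
killed. If the state has an edge outside `K`, both sides are zero. -/
lemma removeVertex_splitEdge_expandMap (he : G.IsLink e a w) (haw : a ≠ w)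
    (hK : IsVertexRemoval K G w) (hKC : K ≤s contract G e a w) (S : State (contract G e a w)) :
    removeVertex hK (splitEdge e a w (expandMap he (Finsupp.single S 1))) =
      delMap hKC (Finsupp.single S 1) := by
  have heS := S.notMem_of_contract
  have hs : after (S.expand he).edges e = after S.edges e := by
    change after (insert e S.edges) e = _
    rw [after_insert heS, if_neg (lt_irrefl _), add_zero]
  rw [expandMap_single, splitEdge, map_smul, signedDescend_single, hs, smul_smul, ← mul_pow,
    neg_one_mul, neg_neg, one_pow, one_smul]
  by_cases hS : (S.edges : Set β) ⊆ E(K)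
  · have hexp := extend_addVertex_eq_expand he hK hKC S hS
    rw [delMap_single, State.del, dif_pos hS, ← hexp]
    have := (descends_mulX he).descend_extend
      (S := State.addVertex hK ⟨S.edges, hS, delComp hKC S.edges ⁻¹' S.colX⟩) trivial heS
    refine (congrArg (removeVertex hK) this).trans ?_
    rw [LinearMap.add_apply, map_add, removeVertex_mulX_addVertex,
      removeVertex_mulX_addVertex_of_ne hK _ haw, zero_add]
  · obtain ⟨S', hg', hS₁, hS'⟩ := exists_extend_insert_eq_single
      (S := S.expand he) (Finset.mem_insert_self e S.edges)
    have hSS : S.edges = S'.edges := by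
      have := congrArg (fun s => s.erase e) hS₁
      simpa [State.expand, Finset.erase_insert heS, Finset.erase_insert hg'] using this
    rw [hSS] at hS
    rw [← hS', (descends_mulX he).descend_extend trivial hg', LinearMap.add_apply, map_add,
      removeVertex_mulX_of_not_subset hK _ hS, removeVertex_mulX_of_not_subset hK _ hS, add_zero,
      delMap_single_of_not_subset hKC (hSS ▸ hS)]

lemma removeVertex_cycleMap_expandMap (he : G.IsLink e a w) (haw : a ≠ w)
    (hK : IsVertexRemoval K G w) (hKC : K ≤s contract G e a w) (h₂ : G.IsLink g₂ w b)
    (h₃ : G.IsLink g₃ b c) (h₄ : G.IsLink g₄ c a) (hg₂ : g₂ ≠ e) (hg₃ : g₃ ≠ e) (hg₄ : g₄ ≠ e)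
    (z : Chains (contract G e a w)) :
    removeVertex hK (cycleMap e g₂ g₃ g₄ a b c w (expandMap he z)) = delMap hKC z := by
  suffices h : removeVertex hK ∘ₗ cycleMap e g₂ g₃ g₄ a b c w ∘ₗ expandMap he = delMap hKC from
    LinearMap.congr_fun h z
  refine Finsupp.lhom_ext' fun S => LinearMap.ext_ring ?_
  have heK : e ∉ E(K) := fun h => (hKC.le.edgeSet_mono h).2 rfl
  have heS : e ∈ (S.expand he).edges := Finset.mem_insert_self e S.edges
  simp only [LinearMap.comp_apply, Finsupp.lsingle_apply, cycleMap, LinearMap.add_apply,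
    LinearMap.sub_apply, map_add, map_sub, removeVertex_splitEdge_expandMap he haw hK hKC]
  simp only [expandMap_single, map_smul, removeVertex_splitEdge_of_ne hK heK hg₂ h₂ heS,
    removeVertex_splitEdge_of_ne hK heK hg₃ h₃ heS, removeVertex_splitEdge_of_ne hK heK hg₄ h₄ heS]
  simp

/-! ### The split short exact sequence -/

lemma exists_section_of_retraction {A B C : Type*} [AddCommGroup A] [AddCommGroup B]
    [AddCommGroup C] {f : A →ₗ[ℤ] B} {g : B →ₗ[ℤ] C} (hfg : Function.Exact f g)
    (hg : Function.Surjective g) {r : B →ₗ[ℤ] A} (hr : r ∘ₗ f = LinearMap.id) :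
    ∃ σ : C →ₗ[ℤ] B, g ∘ₗ σ = LinearMap.id := by
  have h := (hfg.split_tfae' (R := ℤ)).out 0 1
  exact (h.2 ⟨hg, r, hr⟩).2

/-- The middle of the long exact sequence: if the deletion of `z` is the boundary of `w`, then `z`
minus the boundary of the included `w` is deleted to `0`, hence lies in the image of `α`. -/
lemma exact_alphaStar_betaStar [Finite E(G)] [Finite E(H)] {x y : α} (he : G.IsLink e x y)
    (h : H ≤s G) (hE : E(H) = E(G) \ {e}) (i : ℤ) (J : Set ℕ) :
    Function.Exact (alphaStar he i J) (betaStar h (i + 1) J) := by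
  have heH : e ∉ E(H) := hE ▸ fun h' => h'.2 rfl
  intro q
  obtain ⟨⟨z, hz⟩, rfl⟩ := Submodule.Quotient.mk_surjective _ q
  constructor
  · intro hq
    obtain ⟨w, hw, hwz⟩ : delMap h z ∈ coboundaries H (i + 1) J :=
      (Submodule.Quotient.mk_eq_zero
        ((coboundaries H (i + 1) J).submoduleOf (cocycles H (i + 1) J))).1 hq
    have hi := includeMap_mem_cochains h hw
    have hdi : d G (includeMap h w) ∈ cochains G (i + 1) J := d_mem_cochains (by ring) hi
    obtain ⟨y', hy, hyz⟩ := exists_expandMap_eq he h hE (i := i) rfl (J := J)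
      (z := z - d G (includeMap h w)) (sub_mem hz.1 hdi)
      (by rw [map_sub, ← d_delMap, delMap_includeMap, hwz, sub_self])
    have hdz : d G z = 0 := hz.2
    have hdy : d (contract G e x y) y' = 0 := by
      apply expandMap_injective he
      rw [← d_expandMap, hyz, map_sub, hdz, d_comp_d, sub_zero, map_zero]
    refine ⟨Submodule.Quotient.mk ⟨y', hy, hdy⟩, ?_⟩
    refine (Submodule.Quotient.eq _).2 ?_
    refine ⟨-includeMap h w, neg_mem hi, ?_⟩
    change _ = expandMap he y' - z
    rw [hyz, map_neg]
    abel
  · rintro ⟨p, hp⟩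
    obtain ⟨⟨y', hy⟩, rfl⟩ := Submodule.Quotient.mk_surjective _ p
    rw [← hp]
    exact congrArg Submodule.Quotient.mk (Subtype.ext (delMap_expandMap he h heH y'))

/-- The obstruction to lifting `w` is the connecting class of `y'`, where `α y'` is the boundary of
the included `w`. It is killed by `α*`, so it vanishes. Note that `α*` is used one degree above the
one in the short exact sequence. -/
lemma betaStar_surjective_of_alphaStar_injective [Finite E(G)] [Finite E(H)] {x y : α}
    (he : G.IsLink e x y) (h : H ≤s G) (hE : E(H) = E(G) \ {e}) (i : ℤ) (J : Set ℕ)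
    (hα : Function.Injective (alphaStar he (i + 1) J)) :
    Function.Surjective (betaStar h (i + 1) J) := by
  refine Homology.map_surjective fun w hw => ?_
  have hi := includeMap_mem_cochains h hw.1
  have hdw : d H w = 0 := hw.2
  obtain ⟨y', hy, hyz⟩ := exists_expandMap_eq he h hE (i := i + 1) rfl (J := J)
    (z := d G (includeMap h w)) (d_mem_cochains rfl hi)
    (by rw [← d_delMap, delMap_includeMap, hdw])
  have hdy : d (contract G e x y) y' = 0 := by
    apply expandMap_injective he
    rw [← d_expandMap, hyz, d_comp_d, map_zero]
  have h0 : alphaStar he (i + 1) J (Submodule.Quotient.mk ⟨y', hy, hdy⟩) = 0 := by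
    refine (Submodule.Quotient.mk_eq_zero
      ((coboundaries G (i + 1 + 1) J).submoduleOf (cocycles G (i + 1 + 1) J))).2 ?_
    exact ⟨includeMap h w, by rwa [add_sub_cancel_right], hyz.symm⟩
  obtain ⟨v, hv, hvy⟩ : y' ∈ coboundaries (contract G e x y) (i + 1) J :=
    (Submodule.Quotient.mk_eq_zero ((coboundaries (contract G e x y) (i + 1) J).submoduleOf
      (cocycles (contract G e x y) (i + 1) J))).1
      (hα (h0.trans (map_zero (alphaStar he (i + 1) J)).symm))
  have heH : e ∉ E(H) := hE ▸ fun h' => h'.2 rfl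
  refine ⟨includeMap h w - expandMap he v,
    ⟨sub_mem hi (expandMap_mem_cochains he (by ring) hv), ?_⟩, ?_⟩
  · change d G (_ - _) = 0
    rw [map_sub, d_expandMap, hvy, hyz, sub_self]
  · rw [map_sub, delMap_includeMap, delMap_expandMap he h heH, sub_zero]

/-- If `K` is obtained from `G` by removing an end `w` of the edge `e = aw`, every edge of `G / e`
is parallel to an edge of `K`, and `e` lies on a closed walk `a, w, b, c` of length four that
contains it only once, then the deletion–contraction sequence of `e` splits. -/
theorem exists_isSplitShortExact [Finite V(G)] [Finite E(G)] [Finite E(H)] [Finite E(K)]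
    (he : G.IsLink e a w) (haw : a ≠ w) (hH : H ≤s G) (hE : E(H) = E(G) \ {e})
    (hK : IsVertexRemoval K G w) (hKC : K ≤s contract G e a w)
    (hpar : ∀ f ∈ E(contract G e a w) \ E(K), ∃ g ∈ E(K), ∃ u v,
      (contract G e a w).IsLink f u v ∧ (contract G e a w).IsLink g u v)
    (h₂ : G.IsLink g₂ w b) (h₃ : G.IsLink g₃ b c) (h₄ : G.IsLink g₄ c a)
    (hg₂ : g₂ ≠ e) (hg₃ : g₃ ≠ e) (hg₄ : g₄ ≠ e) (i : ℤ) (J : Set ℕ) :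
    ∃ φ : Homology (contract G e a w) i J ≃ₗ[ℤ] Homology K i J,
      (∀ q, φ q = betaStar hKC i J q) ∧
      IsSplitShortExact (alphaStar he i J ∘ₗ φ.symm.toLinearMap) (betaStar hH (i + 1) J) := by
  -- The degree is kept free: injectivity of `α*` is needed in degree `i` and, for the surjectivity
  -- of `β*`, in degree `i + 1`.
  have hbij := fun i => betaStar_bijective _ (contract G e a w) hKC rfl hpar i J
  let ρ : Chains G →ₗ[ℤ] Chains K := removeVertex hK ∘ₗ cycleMap e g₂ g₃ g₄ a b c w
  have hρd : ∀ z, d K (ρ z) = ρ (d G z) := fun z => by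
    simp only [ρ, LinearMap.comp_apply, d_removeVertex, d_cycleMap he h₂ h₃ h₄]
  -- The shift of `J` by one in `cycleMap` is undone by `removeVertex`.
  have hρ : ∀ {i i' : ℤ}, i' + 1 = i → ∀ z ∈ cochains G i J, ρ z ∈ cochains K i' J :=
    fun hi z hz => removeVertex_mem_cochains hK (cycleMap_mem_cochains he h₂ h₃ h₄ hi hz)
  let ρs : ∀ i, Homology G (i + 1) J →ₗ[ℤ] Homology K i J := fun i =>
    Homology.map ρ hρd (i + 1) i J (hρ rfl) (hρ (by ring))
  have hρα : ∀ i q, ρs i (alphaStar he i J q) = betaStar hKC i J q := by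
    intro i q
    obtain ⟨⟨z, hz⟩, rfl⟩ := Submodule.Quotient.mk_surjective _ q
    exact congrArg Submodule.Quotient.mk (Subtype.ext
      (removeVertex_cycleMap_expandMap he haw hK hKC h₂ h₃ h₄ hg₂ hg₃ hg₄ z))
  have hα : ∀ i, Function.Injective (alphaStar he i J) := fun i q q' hq =>
    (hbij i).1 (by rw [← hρα, ← hρα, hq])
  let φ := LinearEquiv.ofBijective (betaStar hKC i J) (hbij i)
  have hex : Function.Exact (alphaStar he i J ∘ₗ φ.symm.toLinearMap) (betaStar hH (i + 1) J) := by
    intro q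
    rw [exact_alphaStar_betaStar he hH hE i J q]
    constructor
    · rintro ⟨p, rfl⟩
      exact ⟨φ p, by simp⟩
    · rintro ⟨p, rfl⟩
      exact ⟨φ.symm p, rfl⟩
  have hsur := betaStar_surjective_of_alphaStar_injective he hH hE i J (hα (i + 1))
  refine ⟨φ, fun _ => rfl, (hα i).comp φ.symm.injective, hex, hsur,
    exists_section_of_retraction hex hsur (r := ρs i) ?_⟩
  refine LinearMap.ext fun q => ?_
  rw [LinearMap.comp_apply, LinearMap.comp_apply, hρα]
  exact φ.apply_symm_apply q

end Retraction

section CompleteGraphs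

/-! ### The graphs `K_{n-1}^m` -/

lemma isLink_completeAdd_of_lt {n m a b : ℕ} (ha : 1 ≤ a) (hab : a < b) (hb : b ≤ n)
    (h : b = n → a ≤ m) : (completeAdd n m).IsLink (toLex (a, b)) a b :=
  ⟨⟨ha, hab, hb, Or.inl ⟨rfl, rfl⟩⟩, fun h' => absurd (h h'.1) (not_le.2 h'.2)⟩

lemma isVertexRemoval_complete {n m : ℕ} (hn : 1 ≤ n) :
    IsVertexRemoval (complete (n - 1)) (completeAdd n m) ⟨n, hn, le_rfl⟩ where
  le := by
    refine ⟨fun v hv => ⟨hv.1, hv.2.trans (Nat.sub_le n 1)⟩, ?_⟩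
    rintro f u v ⟨h1, h2, h3, h4⟩
    exact ⟨⟨h1, h2, by omega, h4⟩, fun h' => by have := h'.1; omega⟩
  notMem h := by
    have : n ≤ n - 1 := h.2
    omega
  eq_or_mem v := by
    have h1 : 1 ≤ v.1 := v.2.1
    have h2 : v.1 ≤ n := v.2.2
    by_cases h : v.1 = n
    · exact Or.inl (Subtype.ext h)
    · exact Or.inr ⟨h1, by omega⟩

/-- The edges `{t, n}`, `t < m`, of the contraction of `{m, n}` are parallel to the edges
`{t, m}`. -/
lemma exists_parallel_complete {n m : ℕ} (hm : 1 ≤ m) (hmn : m < n) :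
    ∀ f ∈ E(contract (completeAdd n m) (toLex (m, n)) m n) \ E(complete (n - 1)),
      ∃ g ∈ E(complete (n - 1)), ∃ u v,
        (contract (completeAdd n m) (toLex (m, n)) m n).IsLink f u v ∧
        (contract (completeAdd n m) (toLex (m, n)) m n).IsLink g u v := by
  have hlink : ∀ {f : ℕ ×ₗ ℕ} {u v : ℕ}, (completeAdd n m).IsLink f u v → f ≠ toLex (m, n) →
      u ≠ n → (contract (completeAdd n m) (toLex (m, n)) m n).IsLink f u (if v = n then m else v) :=
    fun {f u v} h hf hu => ⟨u, v, ⟨h, hf⟩, if_neg hu, by by_cases hv : v = n <;> simp [hv]⟩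
  intro f hf
  obtain ⟨⟨hfG, hfe⟩, hfK⟩ := hf
  obtain ⟨t, b, rfl⟩ : ∃ t b, f = toLex (t, b) := ⟨_, _, rfl⟩
  have hfG : (1 ≤ t ∧ t < b ∧ b ≤ n) ∧ ¬ (b = n ∧ m < t) := hfG
  have hfK : ¬ (1 ≤ t ∧ t < b ∧ b ≤ n - 1) := hfK
  have hfe : toLex (t, b) ≠ toLex (m, n) := hfe
  -- An edge that is missing in `K_{n-1}` must end at the last vertex.
  obtain rfl : b = n := by omega
  have htm : t < m := by
    have : t ≠ m := by rintro rfl; exact hfe rfl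
    omega
  refine ⟨toLex (t, m), ⟨hfG.1.1, htm, by simp; omega⟩, t, m, ?_, ?_⟩
  · have := hlink (isLink_completeAdd_of_lt (m := m) hfG.1.1 hfG.1.2.1 le_rfl (by omega)) hfe
      (by omega)
    rwa [if_pos rfl] at this
  · have := hlink (isLink_completeAdd_of_lt (n := b) (m := m) hfG.1.1 htm hmn.le (by omega))
      (by simp; omega) (by omega)
    rwa [if_neg hmn.ne] at this

theorem exists_isSplitShortExact_complete {n m : ℕ} (hn : 4 ≤ n) (hm : 2 ≤ m) (hmn : m < n)
    (i : ℤ) (J : Set ℕ) :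
    ∃ φ : Homology (contract (completeAdd n m) (toLex (m, n)) m n) i J ≃ₗ[ℤ]
        Homology (complete (n - 1)) i J,
      (∀ q, φ q = betaStar (complete_spanning (le_of_lt hm) hmn) i J q) ∧
      IsSplitShortExact
        (alphaStar (isLink_completeAdd (le_of_lt hm) hmn) i J ∘ₗ φ.symm.toLinearMap)
        (betaStar (completeAdd_spanning (n := n) (le_of_lt hm)) (i + 1) J) := by
  have hV : Finite V(completeAdd n m) := (Set.finite_Icc 1 n).to_subtype
  -- The fourth vertex of the walk `m, n, 1, t` must avoid the other three. For `m = 2` it is `3`,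
  -- which is below `n` because `n ≥ 4`; otherwise it is `2`. The label of the edge `{t, m}` lists
  -- the smaller end first, so it depends on the case.
  obtain ⟨t, g₄, ht1, htn, ht, hg₄, h₄⟩ : ∃ (t : ℕ) (g₄ : ℕ ×ₗ ℕ), 1 < t ∧ t < n ∧ t ≠ m ∧
      g₄ ≠ toLex (m, n) ∧ (completeAdd n m).IsLink g₄ t m := by
    by_cases h : m = 2
    · subst h
      exact ⟨3, toLex (2, 3), by omega, by omega, by omega, by simp; omega,
        (isLink_completeAdd_of_lt (by omega) (by omega) (by omega) (by omega)).symm⟩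
    · exact ⟨2, toLex (2, m), by omega, by omega, by omega, by simp; omega,
        isLink_completeAdd_of_lt (by omega) (by omega) (by omega) (by omega)⟩
  -- The walk uses the edges `{m, n}`, `{n, 1}`, `{1, t}`, `{t, m}`; the second differs from the
  -- first because `m ≥ 2`.
  exact exists_isSplitShortExact (G := completeAdd n m) (a := ⟨m, by omega, by omega⟩) (b := ⟨1, le_rfl, by omega⟩)
    (c := ⟨t, by omega, by omega⟩) (w := ⟨n, by omega, le_rfl⟩)
    (g₂ := toLex (1, n)) (g₃ := toLex (1, t)) (g₄ := g₄)
    (isLink_completeAdd (le_of_lt hm) hmn) (fun h => hmn.ne (congrArg Subtype.val h))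
    (completeAdd_spanning (le_of_lt hm))
    (by rw [← completeAdd_deleteEdges (le_of_lt hm)]; rfl)
    (isVertexRemoval_complete (by omega)) (complete_spanning (le_of_lt hm) hmn)
    (exists_parallel_complete (le_of_lt hm) hmn)
    (isLink_completeAdd_of_lt le_rfl (by omega) le_rfl (by omega)).symm
    (isLink_completeAdd_of_lt le_rfl ht1 htn.le (by omega)) h₄
    (by simp; omega) (by simp; omega) hg₄ i J

end CompleteGraphs

end

end ChromaticHomology

/-- All constructions allow an arbitrary set `J` of `x`-degrees, so the total statement is the case
`J = univ` of the same argument and needs no summation over `j`. -/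
theorem mainTheorem6 (n m : ℕ) (hn : 4 ≤ n) (hm : 2 ≤ m) (hmn : m < n) :
    (∀ (i : ℤ) (j : ℕ),
      ∃ φ : ChromaticHomology.BiHomology
            (ChromaticHomology.contract (ChromaticHomology.completeAdd n m) (toLex (m, n)) m n) i j
          ≃ₗ[ℤ] ChromaticHomology.BiHomology (ChromaticHomology.complete (n - 1)) i j,
        (∀ a, φ a = ChromaticHomology.betaStar
          (ChromaticHomology.complete_spanning (le_of_lt hm) hmn) i {j} a) ∧
        ChromaticHomology.IsSplitShortExact
          (A := ChromaticHomology.BiHomology (ChromaticHomology.complete (n - 1)) i j)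
          (B := ChromaticHomology.BiHomology (ChromaticHomology.completeAdd n m) (i + 1) j)
          (C := ChromaticHomology.BiHomology (ChromaticHomology.completeAdd n (m - 1)) (i + 1) j)
          (ChromaticHomology.alphaStar
            (ChromaticHomology.isLink_completeAdd (le_of_lt hm) hmn) i {j} ∘ₗ φ.symm.toLinearMap)
          (ChromaticHomology.betaStar
            (ChromaticHomology.completeAdd_spanning (le_of_lt hm)) (i + 1) {j})) ∧
    (∀ i : ℤ,
      ∃ φ : ChromaticHomology.TotalHomology
            (ChromaticHomology.contract (ChromaticHomology.completeAdd n m) (toLex (m, n)) m n) i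
          ≃ₗ[ℤ] ChromaticHomology.TotalHomology (ChromaticHomology.complete (n - 1)) i,
        (∀ a, φ a = ChromaticHomology.betaStar
          (ChromaticHomology.complete_spanning (le_of_lt hm) hmn) i Set.univ a) ∧
        ChromaticHomology.IsSplitShortExact
          (A := ChromaticHomology.TotalHomology (ChromaticHomology.complete (n - 1)) i)
          (B := ChromaticHomology.TotalHomology (ChromaticHomology.completeAdd n m) (i + 1))
          (C := ChromaticHomology.TotalHomology (ChromaticHomology.completeAdd n (m - 1)) (i + 1))
          (ChromaticHomology.alphaStar
            (ChromaticHomology.isLink_completeAdd (le_of_lt hm) hmn) i Set.univ ∘ₗ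
              φ.symm.toLinearMap)
          (ChromaticHomology.betaStar
            (ChromaticHomology.completeAdd_spanning (le_of_lt hm)) (i + 1) Set.univ)) := by
  exact ⟨fun i j => ChromaticHomology.exists_isSplitShortExact_complete hn hm hmn i {j},
    fun i => ChromaticHomology.exists_isSplitShortExact_complete hn hm hmn i Set.univ⟩
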